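/- Let $L_1,L_2>0$ be arbitrary and let $\mathbb T^2=\mathbb R^2/(L_1\mathbb Z\times L_2\mathbb Z)$, with Lebesgue measure. For $k\in\mathbb Z^2$ put $\tilde k=2\pi(k_1/L_1,k_2/L_2)$ and $\sigma(k)=|\tilde k|^4-|\tilde k|^2$, and let $\mu=\sup_{k\in\mathbb Z^2}(-\sigma(k))\in[0,1/4]$ be the largest linear growth rate (so $\mu=0$ if there are no linearly growing modes). Let $e^{-t\mathcal L}$, $\mathcal L=\Delta^2+\Delta$, denote the Fourier multiplier with symbol $e^{-t\sigma(k)}$. A mild solution on $[0,T)$ of the two-dimensional Kuramoto–Sivashinsky equation $\partial_t\mathbf u+\nabla(|\mathbf u|^2/2)=-\Delta^2\mathbf u-\Delta\mathbf u$ with initial data $\mathbf u_0$ is a function $\mathbf u\in C([0,T);L^2(\mathbb T^2;\mathbb R^2))$ such that, for all $t\in[0,T)$, $$\mathbf u(t)=e^{-t\mathcal L}\mathbf u_0-\int_0^t e^{-(t-\tau)\mathcal L}\nabla\Big(\frac{|\mathbf u(\tau)|^2}{2}\Big)\,d\tau ,$$ where the integral converges as a Bochner integral in $L^2$. There is a constant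 $C>0$, depending only on $L_1,L_2$, such that the following holds for every $\mathbf u_0\in L^2(\mathbb T^2;\mathbb R^2)$ with zero average and every $0<T<\infty$ with $$e^{T}\max(T,T^{1/2})\cdot 2C\,\|\mathbf u_0\|_{L^2(\mathbb T^2)}<1 .$$ There is a unique mild solution $\mathbf u$ on $[0,T)$ with initial data $\mathbf u_0$. For each $t\in(0,T)$, $\mathbf u(t)$ extends to a function $\mathbf u(\cdot,\cdot,t)$ with values in $\mathbb C^2$, periodic in $\mathbf x$ with periods $L_1,L_2$, and holomorphic in the strip $$\mathcal D_t=\{\mathbf x+i\mathbf y\in\mathbb C^2:\ \mathbf x,\mathbf y\in\mathbb R^2,\ 2C|\mathbf y|<e^{-t}\min(1,t^{1/4})\},$$ and $$\|\mathbf u(\cdot,\mathbf y,t)\|_{L^2(\mathbb T^2)}\le C\,e^{\mu t}\,\|\mathbf u_0\|_{L^2(\mathbb T^2)}\qquad\text{whenever } 2C|\mathbf y|<e^{-t}\min(1,t^{1/4}).$$ -/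

import Mathlib

open MeasureTheory

noncomputable section

namespace KS

/-- The flat torus with periods `L 0`, `L 1`; its `volume` is Lebesgue measure, of total mass
`L 0 * L 1`. -/
abbrev Torus (L : Fin 2 → ℝ) : Type := (i : Fin 2) → AddCircle (L i)

/-- Values of real vector fields, with the Euclidean norm. -/
abbrev Vec : Type := EuclideanSpace ℝ (Fin 2)

/-- The space of square-integrable real vector fields on the torus. -/
abbrev L2Field (L : Fin 2 → ℝ) [∀ i, Fact (0 < L i)] : Type :=
  Lp Vec 2 (volume : Measure (Torus L))

/-- The wave vector `2π (k₁ / L₁, k₂ / L₂)` of the Fourier mode `k`. -/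
def wave (L : Fin 2 → ℝ) (k : Fin 2 → ℤ) (i : Fin 2) : ℝ := 2 * Real.pi * k i / L i

/-- The squared Euclidean length of the wave vector. -/
def waveSq (L : Fin 2 → ℝ) (k : Fin 2 → ℤ) : ℝ := ∑ i, wave L k i ^ 2

/-- The symbol of `Δ² + Δ`. -/
def symbol (L : Fin 2 → ℝ) (k : Fin 2 → ℤ) : ℝ := waveSq L k ^ 2 - waveSq L k

/-- The largest growth rate of the Fourier modes of `exp (-t (Δ² + Δ))`. The supremum is over a
nonempty family bounded by `1 / 4`, and it is nonnegative because `symbol L 0 = 0`. -/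
def growthRate (L : Fin 2 → ℝ) : ℝ := ⨆ k : Fin 2 → ℤ, -symbol L k

/-- The `k`-th Fourier coefficient of a function on the torus,
`(L₁ L₂)⁻¹ ∫ f(x) exp (-2πi (k₁ x₁ / L₁ + k₂ x₂ / L₂)) dx`. -/
def coeff (L : Fin 2 → ℝ) [∀ i, Fact (0 < L i)] (f : Torus L → ℂ) (k : Fin 2 → ℤ) : ℂ :=
  ((∏ i, L i : ℝ) : ℂ)⁻¹ * ∫ x : Torus L, (∏ i, fourier (-(k i)) (x i)) * f x

open Classical in
/-- Inverse Fourier transform: the square-integrable real vector field whose `i`-th component has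
Fourier coefficients `a k i` (there is at most one; the value is `0` if there is none). -/
def invFourier (L : Fin 2 → ℝ) [∀ i, Fact (0 < L i)] (a : (Fin 2 → ℤ) → Fin 2 → ℂ) :
    L2Field L :=
  if h : ∃ g : L2Field L, ∀ k i, coeff L (fun x => ((g x i : ℝ) : ℂ)) k = a k i
  then h.choose else 0

/-- `exp (-t (Δ² + Δ)) f` for a square-integrable vector field `f`. -/
def semigroup (L : Fin 2 → ℝ) [∀ i, Fact (0 < L i)] (t : ℝ) (f : L2Field L) : L2Field L :=
  invFourier L fun k i =>
    (Real.exp (-t * symbol L k) : ℂ) * coeff L (fun x => ((f x i : ℝ) : ℂ)) k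

/-- `exp (-t (Δ² + Δ)) ∇ f` for an integrable scalar function `f` and `t > 0`. -/
def semigroupGrad (L : Fin 2 → ℝ) [∀ i, Fact (0 < L i)] (t : ℝ) (f : Torus L → ℝ) :
    L2Field L :=
  invFourier L fun k i =>
    (Real.exp (-t * symbol L k) : ℂ) *
      (Complex.I * (wave L k i : ℂ) * coeff L (fun x => (f x : ℂ)) k)

/-- `u` is a mild solution on `[0, T)` of `∂ₜ u + ∇ (|u|² / 2) = -Δ² u - Δ u` with initial value
`u₀`: it is continuous from `[0, T)` to `L²` and satisfies Duhamel's formula, in which the integral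
is a convergent Bochner integral in `L²`. -/
structure IsMildSolution (L : Fin 2 → ℝ) [∀ i, Fact (0 < L i)] (T : ℝ) (u₀ : L2Field L)
    (u : ℝ → L2Field L) : Prop where
  continuousOn : ContinuousOn u (Set.Ico 0 T)
  integrable : ∀ t ∈ Set.Ico 0 T,
    IntervalIntegrable (fun τ => semigroupGrad L (t - τ) (fun x => ‖u τ x‖ ^ 2 / 2)) volume 0 t
  duhamel : ∀ t ∈ Set.Ico 0 T,
    u t = semigroup L t u₀ -
      ∫ τ in (0 : ℝ)..t, semigroupGrad L (t - τ) (fun x => ‖u τ x‖ ^ 2 / 2)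

/-- The strip of all `x + i y` in `ℂ²` with `2 C |y| < e^{-t} min (1, t^{1/4})`. -/
def strip (C t : ℝ) : Set (Fin 2 → ℂ) :=
  {z | 2 * C * √(∑ i, (z i).im ^ 2) < Real.exp (-t) * min 1 (t ^ (1 / 4 : ℝ))}

/-- `F` is holomorphic on `D ⊆ ℂ²`, periodic in the real directions, and its restriction to `ℝ²`
is the vector field `f` on the torus. -/
structure IsAnalyticExtension (L : Fin 2 → ℝ) [∀ i, Fact (0 < L i)] (f : L2Field L)
    (D : Set (Fin 2 → ℂ)) (F : (Fin 2 → ℂ) → EuclideanSpace ℂ (Fin 2)) : Prop where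
  analytic : AnalyticOnNhd ℂ F D
  periodic : ∀ z ∈ D, ∀ j, F (z + Pi.single j (L j : ℂ)) = F z
  extends_field : ∀ᵐ x : Fin 2 → ℝ, ∀ i,
    F (fun j => (x j : ℂ)) i = ((f (fun j => (x j : AddCircle (L j))) i : ℝ) : ℂ)

/-- The `L²` norm, over one period cell, of `x ↦ F (x + i y)`. -/
def sliceNorm (L : Fin 2 → ℝ) (F : (Fin 2 → ℂ) → EuclideanSpace ℂ (Fin 2)) (y : Fin 2 → ℝ) :
    ENNReal :=
  eLpNorm (fun x : Fin 2 → ℝ => F (fun j => (x j : ℂ) + (y j : ℂ) * Complex.I)) 2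
    (volume.restrict (Set.univ.pi fun j => Set.Ioc 0 (L j)))

end KS

end

/-!
The proof works with the Fourier coefficients of the solution and with the Gevrey norms
`(∑ₖ e^{2 r |k̃|} |û(k)|²)^{1/2}`. A field for which this norm is finite with radius `r` extends to a
holomorphic function on `|y| < r` (`analyticAt_complexExtension`), and by Parseval's identity the
norm bounds the `L²` norms of the slices `x ↦ u(x + i y)` (`sliceNorm_complexExtension_le`). So it is enough to find a solution whose Gevrey norm with the radius
`ρ(t) = e^{-t} min (1, t^{1/4}) / (2C)` is at most `R e^{μ t}`, where `R` is a multiple of `‖u₀‖`.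

The linear flow damps the mode `k` by `e^{-t σ(k)}`. With `q = min (1, t^{1/4})` the elementary
inequality `-x⁴ + x² + 4x ≤ 6`, applied to `x = q |k̃|`, gives
`e^{-t σ(k)} e^{q |k̃|} (1 + q |k̃|)³ ≤ e⁶ e^{μ t}` (`exp_symbol_mul_exp_scale_le`). Hence the flow
gains the radius `q` (`gevreyBound_semigroup`), and, after summation over the lattice, the symbol of
`e^{-t(Δ² + Δ)} ∇` with the same gain has an `ℓ²` norm of order `e^{μ t} (1 + t^{-1/2})`
(`sum_sq_kernel_le`). Since the weight `e^{r |k̃|}` is submultiplicative, the convolution that gives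
the coefficients of `|u|² / 2` maps the weighted `ℓ²` space to the weighted `ℓ^∞` space
(`weight_mul_norm_energyCoeff_le`). As `ρ(t) ≤ ρ(s) + min (1, (t - s)^{1/4})`, the singularity
`(t - s)^{-1/2}` is integrable, and Duhamel's integral is bounded by a multiple of
`R² e^{2 μ t} max (T, T^{1/2})`. Under the smallness assumption Duhamel's formula therefore maps the
curves with the Gevrey bound to themselves, and it contracts the distance of `C([0, T]; L²)`, in
which these curves form a closed set (`exists_solution`).

Uniqueness holds among all mild solutions: two of them are bounded on compact subintervals, and the
same smoothing estimate, without weights, shows that their difference vanishes on successive short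
time intervals (`IsMildSolution.eqOn`).
-/

noncomputable section

namespace KS

open scoped ComplexConjugate

/-! ### Fourier series on the torus -/

section FourierSeries

variable (L : Fin 2 → ℝ)

/-- The area of the torus. -/
def area : ℝ := ∏ i, L i

/-- The character `x ↦ exp (2πi (k₁ x₁ / L₁ + k₂ x₂ / L₂))` of the torus. -/
def char (k : Fin 2 → ℤ) : C(Torus L, ℂ) where
  toFun x := ∏ i, fourier (k i) (x i)
  continuous_toFun := by fun_prop

lemma char_apply (k : Fin 2 → ℤ) (x : Torus L) : char L k x = ∏ i, fourier (k i) (x i) := rfl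

lemma char_zero : char L 0 = 1 := by
  ext x
  simp [char_apply]

lemma char_neg (k : Fin 2 → ℤ) (x : Torus L) : char L (-k) x = conj (char L k x) := by
  simp only [char_apply, Pi.neg_apply, fourier_neg, map_prod]

lemma char_add (k l : Fin 2 → ℤ) (x : Torus L) :
    char L (k + l) x = char L k x * char L l x := by
  simp only [char_apply, Pi.add_apply, fourier_add, ← Finset.prod_mul_distrib]

lemma norm_char_apply (k : Fin 2 → ℤ) (x : Torus L) : ‖char L k x‖ = 1 := by
  simp only [char_apply, norm_prod, fourier_apply, Circle.norm_coe, Finset.prod_const_one]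

lemma char_single (j : Fin 2) (x : Torus L) : char L (Pi.single j 1) x = fourier 1 (x j) := by
  rw [char_apply, Finset.prod_eq_single j]
  · simp only [Pi.single_eq_same]
  · intro i _ hi
    rw [Pi.single_eq_of_ne hi, fourier_zero]
  · simp

variable [∀ i, Fact (0 < L i)]

lemma period_pos (i : Fin 2) : 0 < L i := Fact.out

lemma area_pos : 0 < area L := Finset.prod_pos fun i _ => period_pos L i

lemma coeff_eq (f : Torus L → ℂ) (k : Fin 2 → ℤ) :
    coeff L f k = ((area L : ℝ) : ℂ)⁻¹ * ∫ x : Torus L, char L (-k) x * f x := rfl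

lemma volume_univ_toReal : (volume : Measure (Torus L)).real Set.univ = area L := by
  simp [Measure.real, volume_pi, Measure.pi_univ, area,
    ENNReal.toReal_ofReal (period_pos L _).le]

instance : IsFiniteMeasure (volume : Measure (Torus L)) := by
  rw [volume_pi]; infer_instance

lemma integral_fourier (T : ℝ) [Fact (0 < T)] {n : ℤ} (hn : n ≠ 0) :
    ∫ x : AddCircle T, fourier n x = 0 :=
  integral_eq_zero_of_add_right_eq_neg (fourier_add_half_inv_index hn Fact.out)

lemma integral_char (k : Fin 2 → ℤ) :
    ∫ x, char L k x = if k = 0 then ((area L : ℝ) : ℂ) else 0 := by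
  split_ifs with h
  · subst h
    rw [char_zero]
    simp [volume_univ_toReal]
  · simp only [char_apply]
    rw [integral_fintype_prod_volume_eq_prod (fun i (x : AddCircle (L i)) => fourier (k i) x)]
    obtain ⟨i, hi⟩ := Function.ne_iff.mp h
    exact Finset.prod_eq_zero (Finset.mem_univ i) (integral_fourier _ hi)

/-- The trigonometric polynomials form a star subalgebra of the continuous functions. -/
def trigPoly : StarSubalgebra ℂ C(Torus L, ℂ) where
  toSubalgebra := Algebra.adjoin ℂ (Set.range (char L))
  star_mem' := by
    change Algebra.adjoin ℂ (Set.range (char L)) ≤ star (Algebra.adjoin ℂ (Set.range (char L)))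
    refine Algebra.adjoin_le ?_
    rintro _ ⟨n, rfl⟩
    refine Algebra.subset_adjoin ⟨-n, ?_⟩
    ext1 x
    simp only [char_neg, starRingEnd_apply, ContinuousMap.star_apply]

lemma trigPoly_coe :
    (trigPoly L).toSubalgebra.toSubmodule = Submodule.span ℂ (Set.range (char L)) := by
  apply Algebra.adjoin_eq_span_of_subset
  refine .trans (fun x ↦ Submonoid.closure_induction (fun _ ↦ id) ⟨0, char_zero L⟩ ?_)
    Submodule.subset_span
  rintro _ _ _ _ ⟨m, rfl⟩ ⟨n, rfl⟩
  exact ⟨m + n, ContinuousMap.ext fun z => char_add L m n z⟩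

lemma trigPoly_separatesPoints : (trigPoly L).SeparatesPoints := by
  intro x y hxy
  rw [Ne, funext_iff, not_forall] at hxy
  obtain ⟨i, hi⟩ := hxy
  refine ⟨_, ⟨char L (Pi.single i 1), Algebra.subset_adjoin ⟨Pi.single i 1, rfl⟩, rfl⟩, ?_⟩
  intro h
  have h1 : char L (Pi.single i 1) x = char L (Pi.single i 1) y := h
  rw [char_single, char_single, fourier_one, fourier_one] at h1
  refine hi ?_
  have h2 : AddCircle.toCircle (x i) = AddCircle.toCircle (y i) := Subtype.ext h1
  exact AddCircle.injective_toCircle (period_pos L i).ne' h2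

lemma span_char_closure_eq_top :
    (Submodule.span ℂ (Set.range (char L))).topologicalClosure = ⊤ := by
  rw [← trigPoly_coe]
  exact congr_arg (Subalgebra.toSubmodule <| StarSubalgebra.toSubalgebra ·)
    (ContinuousMap.starSubalgebra_topologicalClosure_eq_top_of_separatesPoints _
      (trigPoly_separatesPoints L))

/-- The characters, normalised in `L²` of the torus with its Lebesgue measure. -/
def charLp (k : Fin 2 → ℤ) : Lp ℂ 2 (volume : Measure (Torus L)) :=
  ((√(area L) : ℝ) : ℂ)⁻¹ • ContinuousMap.toLp (E := ℂ) 2 volume ℂ (char L k)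

lemma sqrt_area_ne_zero : ((√(area L) : ℝ) : ℂ) ≠ 0 :=
  Complex.ofReal_ne_zero.mpr (Real.sqrt_pos.mpr (area_pos L)).ne'

lemma sqrt_area_mul_self : ((√(area L) : ℝ) : ℂ) * ((√(area L) : ℝ) : ℂ) = area L := by
  rw [← Complex.ofReal_mul, Real.mul_self_sqrt (area_pos L).le]

lemma orthonormal_charLp : Orthonormal ℂ (charLp L) := by
  rw [orthonormal_iff_ite]
  intro m n
  have hne := sqrt_area_ne_zero L
  rw [charLp, charLp, inner_smul_left, inner_smul_right, ContinuousMap.inner_toLp]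
  simp only [← char_neg, ← char_add]
  rw [integral_char]
  have : n + -m = 0 ↔ m = n := by rw [add_neg_eq_zero, eq_comm]
  simp only [this]
  split_ifs
  · rw [← sqrt_area_mul_self, map_inv₀, Complex.conj_ofReal]
    field_simp
  · simp

lemma span_charLp_closure_eq_top :
    (Submodule.span ℂ (Set.range (charLp L))).topologicalClosure = ⊤ := by
  have h := (ContinuousMap.toLp_denseRange ℂ (volume : Measure (Torus L)) ℂ
    (p := 2) (by simp)).topologicalClosure_map_submodule (span_char_closure_eq_top L)
  rw [← h]
  congr 1
  rw [Submodule.map_span]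
  refine le_antisymm (Submodule.span_le.mpr ?_) (Submodule.span_le.mpr ?_)
  · rintro _ ⟨k, rfl⟩
    exact Submodule.smul_mem _ _ (Submodule.subset_span ⟨char L k, ⟨k, rfl⟩, rfl⟩)
  · rintro _ ⟨_, ⟨k, rfl⟩, rfl⟩
    have : ContinuousMap.toLp (E := ℂ) 2 volume ℂ (char L k)
        = ((√(area L) : ℝ) : ℂ) • charLp L k := by
      rw [charLp, smul_inv_smul₀ (sqrt_area_ne_zero L)]
    exact this ▸ Submodule.smul_mem _ _ (Submodule.subset_span ⟨k, rfl⟩)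

/-- The Hilbert basis of normalised characters. -/
def charBasis : HilbertBasis (Fin 2 → ℤ) ℂ (Lp ℂ 2 (volume : Measure (Torus L))) :=
  HilbertBasis.mk (orthonormal_charLp L) (span_charLp_closure_eq_top L).ge

lemma charBasis_repr (f : Lp ℂ 2 (volume : Measure (Torus L))) (k : Fin 2 → ℤ) :
    (charBasis L).repr f k = ((√(area L) : ℝ) : ℂ) * coeff L f k := by
  have hne := sqrt_area_ne_zero L
  rw [HilbertBasis.repr_apply_apply, charBasis, HilbertBasis.coe_mk, charLp, inner_smul_left,
    L2.inner_def, coeff_eq, ← sqrt_area_mul_self, map_inv₀, Complex.conj_ofReal]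
  have : ∫ x, inner ℂ (ContinuousMap.toLp (E := ℂ) 2 volume ℂ (char L k) x) (f x)
      = ∫ x, char L (-k) x * f x := by
    apply integral_congr_ae
    filter_upwards [ContinuousMap.coeFn_toLp (p := 2) (𝕜 := ℂ) volume (char L k)] with x hx
    rw [hx, char_neg, RCLike.inner_apply, mul_comm]
  rw [this]
  field_simp

variable {L}

lemma coeff_congr {f g : Torus L → ℂ} (h : f =ᵐ[volume] g) (k : Fin 2 → ℤ) :
    coeff L f k = coeff L g k := by
  rw [coeff_eq, coeff_eq]
  congr 1
  apply integral_congr_ae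
  filter_upwards [h] with x hx
  rw [hx]

/-- Parseval's identity for inner products of square-integrable functions. -/
lemma hasSum_conj_coeff_mul_coeff {f g : Torus L → ℂ} (hf : MemLp f 2 volume)
    (hg : MemLp g 2 volume) :
    HasSum (fun k => conj (coeff L f k) * coeff L g k)
      (((area L : ℝ) : ℂ)⁻¹ * ∫ x, conj (f x) * g x) := by
  have hne := sqrt_area_ne_zero L
  have h := (charBasis L).hasSum_inner_mul_inner hf.toLp hg.toLp
  have h2 := h.mul_left (((area L : ℝ) : ℂ)⁻¹)
  have h3 : ((area L : ℝ) : ℂ)⁻¹ * ∫ x, conj (f x) * g x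
      = ((area L : ℝ) : ℂ)⁻¹ * inner ℂ hf.toLp hg.toLp := by
    congr 1
    rw [L2.inner_def]
    apply integral_congr_ae
    filter_upwards [hf.coeFn_toLp, hg.coeFn_toLp] with x hx hx'
    rw [hx, hx', RCLike.inner_apply, mul_comm]
  rw [h3]
  refine h2.congr_fun fun k => ?_
  rw [← inner_conj_symm, ← HilbertBasis.repr_apply_apply, ← HilbertBasis.repr_apply_apply,
    charBasis_repr, charBasis_repr, coeff_congr hf.coeFn_toLp, coeff_congr hg.coeFn_toLp,
    ← sqrt_area_mul_self, map_mul, Complex.conj_ofReal]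
  field_simp

/-- Parseval's identity for square-integrable functions. -/
lemma hasSum_norm_coeff_sq {f : Torus L → ℂ} (hf : MemLp f 2 volume) :
    HasSum (fun k => ‖coeff L f k‖ ^ 2) ((area L)⁻¹ * ∫ x, ‖f x‖ ^ 2) := by
  have h := hasSum_conj_coeff_mul_coeff hf hf
  have h1 : ∀ z : ℂ, conj z * z = ((‖z‖ ^ 2 : ℝ) : ℂ) := fun z => by
    rw [Complex.conj_mul']; push_cast; rfl
  simp only [h1] at h
  rw [integral_complex_ofReal, ← Complex.ofReal_inv, ← Complex.ofReal_mul] at h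
  exact Complex.hasSum_ofReal.mp h

/-- The Riesz-Fischer theorem. -/
lemma exists_coeff_eq {a : (Fin 2 → ℤ) → ℂ} (ha : Summable fun k => ‖a k‖ ^ 2) :
    ∃ f : Torus L → ℂ, MemLp f 2 volume ∧ ∀ k, coeff L f k = a k := by
  have hne := sqrt_area_ne_zero L
  have hmem : Memℓp (fun k => ((√(area L) : ℝ) : ℂ) * a k) 2 := by
    rw [memℓp_gen_iff (by norm_num)]
    simp only [ENNReal.toReal_ofNat, Real.rpow_ofNat, norm_mul, mul_pow]
    exact ha.mul_left _
  refine ⟨(charBasis L).repr.symm ⟨_, hmem⟩, Lp.memLp _, fun k => ?_⟩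
  have h := charBasis_repr L ((charBasis L).repr.symm ⟨_, hmem⟩) k
  rw [LinearIsometryEquiv.apply_symm_apply] at h
  exact (mul_left_cancel₀ hne h).symm

lemma integrable_char_mul {f : Torus L → ℂ} (hf : Integrable f) (k : Fin 2 → ℤ) :
    Integrable fun x => char L k x * f x :=
  hf.bdd_mul (c := 1) (char L k).continuous.aestronglyMeasurable
    (ae_of_all _ fun x => (norm_char_apply L k x).le)

lemma coeff_sub {f g : Torus L → ℂ} (hf : Integrable f) (hg : Integrable g) (k : Fin 2 → ℤ) :
    coeff L (fun x => f x - g x) k = coeff L f k - coeff L g k := by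
  simp only [coeff_eq, mul_sub]
  rw [integral_sub (integrable_char_mul hf _) (integrable_char_mul hg _), mul_sub]

lemma coeff_add {f g : Torus L → ℂ} (hf : Integrable f) (hg : Integrable g) (k : Fin 2 → ℤ) :
    coeff L (fun x => f x + g x) k = coeff L f k + coeff L g k := by
  simp only [coeff_eq, mul_add]
  rw [integral_add (integrable_char_mul hf _) (integrable_char_mul hg _), mul_add]

lemma coeff_const_mul (c : ℂ) (f : Torus L → ℂ) (k : Fin 2 → ℤ) :
    coeff L (fun x => c * f x) k = c * coeff L f k := by
  simp only [coeff_eq, mul_left_comm _ c]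
  rw [integral_const_mul, mul_left_comm]

lemma coeff_conj (f : Torus L → ℂ) (k : Fin 2 → ℤ) :
    coeff L (fun x => conj (f x)) k = conj (coeff L f (-k)) := by
  rw [coeff_eq, coeff_eq, map_mul, map_inv₀, Complex.conj_ofReal, ← integral_conj]
  simp only [map_mul, ← char_neg, neg_neg]

lemma coeff_char_mul (f : Torus L → ℂ) (k l : Fin 2 → ℤ) :
    coeff L (fun x => char L l x * f x) k = coeff L f (k - l) := by
  rw [coeff_eq, coeff_eq]
  simp only [← mul_assoc, ← char_add]
  rw [show -k + l = -(k - l) by abel]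

lemma coeff_char (k l : Fin 2 → ℤ) : coeff L (char L l) k = if k = l then 1 else 0 := by
  rw [coeff_eq]
  simp only [← char_add]
  rw [integral_char]
  simp only [neg_add_eq_zero]
  split_ifs
  · exact inv_mul_cancel₀ (Complex.ofReal_ne_zero.mpr (area_pos L).ne')
  · simp

lemma norm_coeff_le (f : Torus L → ℂ) (k : Fin 2 → ℤ) :
    ‖coeff L f k‖ ≤ (area L)⁻¹ * ∫ x, ‖f x‖ := by
  rw [coeff_eq, norm_mul, norm_inv, Complex.norm_real, Real.norm_of_nonneg (area_pos L).le]
  refine mul_le_mul_of_nonneg_left ?_ (inv_nonneg.mpr (area_pos L).le)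
  refine (norm_integral_le_integral_norm _).trans_eq ?_
  simp only [norm_mul, norm_char_apply, one_mul]

/-- A square-integrable function is determined by its Fourier coefficients. -/
lemma ae_eq_of_coeff_eq {f g : Torus L → ℂ} (hf : MemLp f 2 volume) (hg : MemLp g 2 volume)
    (h : ∀ k, coeff L f k = coeff L g k) : f =ᵐ[volume] g := by
  have key : hf.toLp = hg.toLp := by
    apply (charBasis L).repr.injective
    ext k
    rw [charBasis_repr, charBasis_repr, coeff_congr hf.coeFn_toLp, coeff_congr hg.coeFn_toLp, h]
  exact (MemLp.toLp_eq_toLp_iff hf hg).mp key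

/-- An absolutely convergent trigonometric series is continuous, with its coefficients as Fourier
coefficients. -/
lemma exists_continuous_coeff_eq {a : (Fin 2 → ℤ) → ℂ} (ha : Summable fun k => ‖a k‖) :
    ∃ f : C(Torus L, ℂ), (∀ x, HasSum (fun k => a k * char L k x) (f x)) ∧
      ∀ k, coeff L f k = a k := by
  have hs : Summable fun k => a k • char L k := by
    refine Summable.of_norm_bounded ha fun k => ?_
    rw [norm_smul]
    refine mul_le_of_le_one_right (norm_nonneg _) ?_
    exact (ContinuousMap.norm_le _ zero_le_one).mpr fun x => (norm_char_apply L k x).le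
  obtain ⟨f, hf⟩ := hs
  refine ⟨f, fun x => ?_, fun k => ?_⟩
  · exact hf.mapL (ContinuousMap.evalCLM ℂ x)
  · have h1 := ((ContinuousMap.toLp (E := ℂ) 2 (volume : Measure (Torus L)) ℂ).hasSum hf).mapL
      (innerSL ℂ (charLp L k))
    have h2 : ∀ g : C(Torus L, ℂ), innerSL ℂ (charLp L k)
        (ContinuousMap.toLp (E := ℂ) 2 (volume : Measure (Torus L)) ℂ g)
        = ((√(area L) : ℝ) : ℂ) * coeff L g k := by
      intro g
      have := charBasis_repr L (ContinuousMap.toLp (E := ℂ) 2 (volume : Measure (Torus L)) ℂ g) k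
      rw [HilbertBasis.repr_apply_apply, charBasis, HilbertBasis.coe_mk] at this
      rw [innerSL_apply_apply, this, coeff_congr (ContinuousMap.coeFn_toLp volume g)]
    have h3 : ∀ l, coeff L (⇑(a l • char L l)) k = if l = k then a l else 0 := by
      intro l
      have : coeff L (⇑(a l • char L l)) k = a l * coeff L (char L l) k :=
        coeff_const_mul (a l) (char L l) k
      rw [this, coeff_char]
      simp only [eq_comm, mul_ite, mul_one, mul_zero]
    have h4 : HasSum (fun l => ((√(area L) : ℝ) : ℂ) * if l = k then a l else 0)
        (((√(area L) : ℝ) : ℂ) * coeff L f k) := by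
      rw [← h2 f]
      refine h1.congr_fun fun l => ?_
      rw [h2, h3]
    have h5 := hasSum_ite_eq k (((√(area L) : ℝ) : ℂ) * a k)
    refine mul_left_cancel₀ (sqrt_area_ne_zero L) (h4.unique (h5.congr_fun fun l => ?_))
    split_ifs with h
    · rw [h]
    · simp

end FourierSeries

/-! ### Fourier coefficients of square-integrable vector fields -/

section Fields

variable {L : Fin 2 → ℝ} [∀ i, Fact (0 < L i)]

/-- The `k`-th Fourier coefficient of the `i`-th component of a square-integrable field. -/
def fieldCoeff (f : L2Field L) (k : Fin 2 → ℤ) (i : Fin 2) : ℂ :=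
  coeff L (fun x => ((f x i : ℝ) : ℂ)) k

lemma memLp_component (f : L2Field L) (i : Fin 2) :
    MemLp (fun x => ((f x i : ℝ) : ℂ)) 2 (volume : Measure (Torus L)) := by
  refine (Lp.memLp f).of_le ?_ (ae_of_all _ fun x => ?_)
  · exact Complex.continuous_ofReal.comp_aestronglyMeasurable
      ((EuclideanSpace.proj (𝕜 := ℝ) i).continuous.comp_aestronglyMeasurable
        (Lp.aestronglyMeasurable f))
  · rw [Complex.norm_real]
    exact PiLp.norm_apply_le (f x) i

lemma integrable_component (f : L2Field L) (i : Fin 2) :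
    Integrable (fun x => ((f x i : ℝ) : ℂ)) (volume : Measure (Torus L)) :=
  (memLp_component f i).integrable (by norm_num)

lemma fieldCoeff_sub (f g : L2Field L) (k : Fin 2 → ℤ) (i : Fin 2) :
    fieldCoeff (f - g) k i = fieldCoeff f k i - fieldCoeff g k i := by
  rw [fieldCoeff, fieldCoeff, fieldCoeff, ← coeff_sub (integrable_component f i)
    (integrable_component g i)]
  apply coeff_congr
  filter_upwards [Lp.coeFn_sub f g] with x hx
  rw [hx, Pi.sub_apply, PiLp.sub_apply, Complex.ofReal_sub]

lemma fieldCoeff_add (f g : L2Field L) (k : Fin 2 → ℤ) (i : Fin 2) :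
    fieldCoeff (f + g) k i = fieldCoeff f k i + fieldCoeff g k i := by
  rw [fieldCoeff, fieldCoeff, fieldCoeff, ← coeff_add (integrable_component f i)
    (integrable_component g i)]
  apply coeff_congr
  filter_upwards [Lp.coeFn_add f g] with x hx
  rw [hx, Pi.add_apply, PiLp.add_apply, Complex.ofReal_add]

lemma fieldCoeff_smul (c : ℝ) (f : L2Field L) (k : Fin 2 → ℤ) (i : Fin 2) :
    fieldCoeff (c • f) k i = c • fieldCoeff f k i := by
  rw [fieldCoeff, fieldCoeff, Complex.real_smul, ← coeff_const_mul]
  apply coeff_congr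
  filter_upwards [Lp.coeFn_smul c f] with x hx
  simp [hx]

lemma fieldCoeff_neg_index (f : L2Field L) (k : Fin 2 → ℤ) (i : Fin 2) :
    fieldCoeff f (-k) i = conj (fieldCoeff f k i) := by
  have h := coeff_conj (fun x => ((f x i : ℝ) : ℂ)) (-k)
  simp only [Complex.conj_ofReal, neg_neg] at h
  exact h

lemma norm_sq_eq_integral (f : L2Field L) : ‖f‖ ^ 2 = ∫ x, ‖f x‖ ^ 2 := by
  rw [← real_inner_self_eq_norm_sq, L2.inner_def]
  simp only [real_inner_self_eq_norm_sq]

lemma integrable_norm_sq (f : L2Field L) : Integrable fun x => ‖f x‖ ^ 2 :=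
  (Lp.memLp f).integrable_norm_pow (by norm_num)

/-- Parseval's identity for vector fields. -/
lemma hasSum_norm_fieldCoeff_sq (f : L2Field L) :
    HasSum (fun k => ∑ i, ‖fieldCoeff f k i‖ ^ 2) ((area L)⁻¹ * ‖f‖ ^ 2) := by
  have h := hasSum_sum (s := Finset.univ) fun i _ => hasSum_norm_coeff_sq (memLp_component f i)
  suffices e : (area L)⁻¹ * ‖f‖ ^ 2
      = ∑ i, (area L)⁻¹ * ∫ x, ‖((f x i : ℝ) : ℂ)‖ ^ 2 by
    rw [e]; exact h
  rw [← Finset.mul_sum, ← integral_finsetSum, norm_sq_eq_integral]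
  · congr 2
    ext x
    rw [EuclideanSpace.norm_sq_eq]
    simp only [Complex.norm_real]
  · intro i _
    exact (memLp_component f i).integrable_norm_pow (by norm_num)

lemma norm_fieldCoeff_le (f : L2Field L) (k : Fin 2 → ℤ) (i : Fin 2) :
    ‖fieldCoeff f k i‖ ≤ (√(area L))⁻¹ * ‖f‖ := by
  have h1 := (hasSum_norm_fieldCoeff_sq f).summable.le_tsum k
    (fun j _ => Finset.sum_nonneg fun i _ => sq_nonneg _)
  rw [(hasSum_norm_fieldCoeff_sq f).tsum_eq] at h1
  have h2 := Finset.single_le_sum (f := fun i => ‖fieldCoeff f k i‖ ^ 2)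
    (fun i _ => sq_nonneg _) (Finset.mem_univ i)
  refine le_of_sq_le_sq ?_ (by positivity)
  rw [mul_pow, inv_pow, Real.sq_sqrt (area_pos L).le]
  exact h2.trans h1

/-- The Fourier coefficients as continuous linear functionals. -/
def fieldCoeffL (k : Fin 2 → ℤ) (i : Fin 2) : L2Field L →L[ℝ] ℂ :=
  LinearMap.mkContinuous
    { toFun := fun f => fieldCoeff f k i
      map_add' := fun f g => fieldCoeff_add f g k i
      map_smul' := fun c f => fieldCoeff_smul c f k i } (√(area L))⁻¹
    fun f => norm_fieldCoeff_le f k i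

lemma fieldCoeffL_apply (f : L2Field L) (k : Fin 2 → ℤ) (i : Fin 2) :
    fieldCoeffL k i f = fieldCoeff f k i := rfl

/-- A square-summable family with the Hermitian symmetry is the family of Fourier coefficients of
a real vector field. -/
lemma exists_fieldCoeff_eq {a : (Fin 2 → ℤ) → Fin 2 → ℂ}
    (ha : ∀ i, Summable fun k => ‖a k i‖ ^ 2) (hsymm : ∀ k i, a (-k) i = conj (a k i)) :
    ∃ g : L2Field L, ∀ k i, fieldCoeff g k i = a k i := by
  choose φ hφ hφa using fun i => exists_coeff_eq (L := L) (ha i)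
  have hreal : ∀ i, ∀ᵐ x, conj (φ i x) = φ i x := fun i => by
    refine ae_eq_of_coeff_eq (f := fun x => conj (φ i x)) ?_ (hφ i) fun k => ?_
    · refine (hφ i).of_le (Complex.continuous_conj.comp_aestronglyMeasurable
        (hφ i).aestronglyMeasurable) (ae_of_all _ fun x => ?_)
      simp
    · rw [coeff_conj, hφa, hφa, hsymm, Complex.conj_conj]
  have hmem : MemLp (fun x => WithLp.toLp 2 fun i => (φ i x).re : Torus L → Vec) 2 volume := by
    refine MemLp.of_eval_piLp (q := 2) fun i => ?_
    exact (hφ i).re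
  refine ⟨hmem.toLp, fun k i => ?_⟩
  rw [← hφa i k]
  apply coeff_congr
  filter_upwards [hmem.coeFn_toLp, hreal i] with x hx hx'
  rw [hx]
  exact Complex.conj_eq_iff_re.mp hx'

lemma fieldCoeff_invFourier {a : (Fin 2 → ℤ) → Fin 2 → ℂ}
    (ha : ∀ i, Summable fun k => ‖a k i‖ ^ 2) (hsymm : ∀ k i, a (-k) i = conj (a k i))
    (k : Fin 2 → ℤ) (i : Fin 2) : fieldCoeff (invFourier L a) k i = a k i := by
  have h : ∃ g : L2Field L, ∀ k i, coeff L (fun x => ((g x i : ℝ) : ℂ)) k = a k i :=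
    exists_fieldCoeff_eq ha hsymm
  rw [fieldCoeff, invFourier, dif_pos h]
  exact h.choose_spec k i

/-- Dominated convergence on the Fourier side: a family of fields is continuous if its Fourier
coefficients are continuous and dominated by a fixed square-summable sequence. -/
lemma continuousOn_of_fieldCoeff {X : Type*} [TopologicalSpace X] {s : Set X}
    {g : X → L2Field L} {b : (Fin 2 → ℤ) → ℝ} (hb : Summable fun k => b k ^ 2)
    (hg : ∀ k i, ContinuousOn (fun x => fieldCoeff (g x) k i) s)
    (hgb : ∀ x ∈ s, ∀ k i, ‖fieldCoeff (g x) k i‖ ≤ b k) : ContinuousOn g s := by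
  intro x₀ hx₀
  have key : Filter.Tendsto (fun x => ∑' k, ∑ i, ‖fieldCoeff (g x - g x₀) k i‖ ^ 2)
      (nhdsWithin x₀ s) (nhds (∑' _ : Fin 2 → ℤ, 0)) := by
    refine tendsto_tsum_of_dominated_convergence (bound := fun k => ∑ _i : Fin 2, 4 * b k ^ 2)
      (summable_sum fun i _ => hb.mul_left 4) (fun k => ?_) ?_
    · rw [← Finset.sum_const_zero (s := (Finset.univ : Finset (Fin 2)))]
      refine tendsto_finsetSum _ fun i _ => ?_
      have h1 : Filter.Tendsto (fun x => fieldCoeff (g x) k i - fieldCoeff (g x₀) k i)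
          (nhdsWithin x₀ s) (nhds 0) := by
        have := (hg k i x₀ hx₀).tendsto.sub_const (fieldCoeff (g x₀) k i)
        rwa [sub_self] at this
      have h2 := h1.norm.pow 2
      simp only [norm_zero, ne_eq, OfNat.ofNat_ne_zero, not_false_eq_true, zero_pow] at h2
      simpa only [fieldCoeff_sub] using h2
    · filter_upwards [self_mem_nhdsWithin] with x hx k
      rw [Real.norm_of_nonneg (Finset.sum_nonneg fun i _ => sq_nonneg _)]
      refine Finset.sum_le_sum fun i _ => ?_
      rw [fieldCoeff_sub]
      have h1 := norm_sub_le (fieldCoeff (g x) k i) (fieldCoeff (g x₀) k i)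
      have h2 := hgb x hx k i
      have h3 := hgb x₀ hx₀ k i
      have h4 := norm_nonneg (fieldCoeff (g x) k i - fieldCoeff (g x₀) k i)
      nlinarith
  have h2 : ∀ x, ∑' k, ∑ i, ‖fieldCoeff (g x - g x₀) k i‖ ^ 2 = (area L)⁻¹ * ‖g x - g x₀‖ ^ 2 :=
    fun x => (hasSum_norm_fieldCoeff_sq _).tsum_eq
  simp only [h2, tsum_zero] at key
  have h3 := (key.const_mul (area L)).sqrt
  simp only [mul_inv_cancel_left₀ (area_pos L).ne', Real.sqrt_sq (norm_nonneg _), mul_zero,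
    Real.sqrt_zero] at h3
  exact tendsto_iff_norm_sub_tendsto_zero.mpr h3

/-! ### The kinetic energy density of a field -/

/-- The `k`-th Fourier coefficient of `|f|² / 2`. -/
def energyCoeff (f : L2Field L) (k : Fin 2 → ℤ) : ℂ :=
  coeff L (fun x => ((‖f x‖ ^ 2 / 2 : ℝ) : ℂ)) k

lemma energyCoeff_neg (f : L2Field L) (k : Fin 2 → ℤ) :
    energyCoeff f (-k) = conj (energyCoeff f k) := by
  have h := coeff_conj (L := L) (fun x => ((‖f x‖ ^ 2 / 2 : ℝ) : ℂ)) (-k)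
  simp only [Complex.conj_ofReal, neg_neg] at h
  exact h

lemma integrable_energy (f : L2Field L) :
    Integrable (fun x => ((‖f x‖ ^ 2 / 2 : ℝ) : ℂ)) (volume : Measure (Torus L)) :=
  ((integrable_norm_sq f).div_const 2).ofReal

lemma norm_energyCoeff_sub_le (f g : L2Field L) (k : Fin 2 → ℤ) :
    ‖energyCoeff f k - energyCoeff g k‖
      ≤ (area L)⁻¹ * (‖f - g‖ * (‖f‖ + ‖g‖) / 2) := by
  rw [energyCoeff, energyCoeff, ← coeff_sub (integrable_energy f) (integrable_energy g)]
  refine (norm_coeff_le _ k).trans ?_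
  refine mul_le_mul_of_nonneg_left ?_ (inv_nonneg.mpr (area_pos L).le)
  have h1 : ∀ᵐ x, ‖((‖f x‖ ^ 2 / 2 : ℝ) : ℂ) - ((‖g x‖ ^ 2 / 2 : ℝ) : ℂ)‖
      = ‖(inner ℝ ((f - g) x) ((f + g) x) : ℝ)‖ / 2 := by
    filter_upwards [Lp.coeFn_sub f g, Lp.coeFn_add f g] with x hx hx'
    rw [hx, hx', Pi.sub_apply, Pi.add_apply, ← Complex.ofReal_sub, Complex.norm_real,
      inner_sub_left, inner_add_right, inner_add_right, real_inner_self_eq_norm_sq,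
      real_inner_self_eq_norm_sq, real_inner_comm (g x) (f x)]
    rw [← Real.norm_of_nonneg (zero_le_two (α := ℝ)), ← norm_div, Real.norm_of_nonneg
      (zero_le_two (α := ℝ))]
    congr 1
    ring
  rw [integral_congr_ae h1, integral_div]
  refine div_le_div_of_nonneg_right ?_ zero_le_two
  have h2 : ∫ x, ‖(inner ℝ ((f - g) x) ((f + g) x) : ℝ)‖
      ≤ ∫ x, ‖(f - g) x‖ * ‖(f + g) x‖ := by
    refine integral_mono (L2.integrable_inner (𝕜 := ℝ) _ _).norm ?_ fun x => norm_inner_le_norm _ _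
    exact (Lp.memLp (f - g)).norm.integrable_mul (Lp.memLp (f + g)).norm
  have h3 : ∫ x, ‖(f - g) x‖ * ‖(f + g) x‖ ≤ ‖f - g‖ * ‖f + g‖ := by
    have h4 := integral_mul_norm_le_Lp_mul_Lq (μ := (volume : Measure (Torus L)))
      (f := fun x => (f - g) x) (g := fun x => (f + g) x) (p := 2) (q := 2)
      Real.HolderConjugate.two_two (by simpa using Lp.memLp (f - g))
      (by simpa using Lp.memLp (f + g))
    refine h4.trans_eq ?_
    simp only [Real.rpow_ofNat, ← norm_sq_eq_integral, ← Real.sqrt_eq_rpow,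
      Real.sqrt_sq (norm_nonneg _)]
  exact h2.trans (h3.trans (mul_le_mul_of_nonneg_left (norm_add_le f g) (norm_nonneg _)))

lemma norm_energyCoeff_le (f : L2Field L) (k : Fin 2 → ℤ) :
    ‖energyCoeff f k‖ ≤ (area L)⁻¹ * (‖f‖ ^ 2 / 2) := by
  refine (norm_coeff_le _ k).trans_eq ?_
  rw [norm_sq_eq_integral, ← integral_div]
  congr 2
  ext x
  rw [Complex.norm_real, Real.norm_of_nonneg (by positivity)]

lemma continuous_energyCoeff (k : Fin 2 → ℤ) :
    Continuous fun f : L2Field L => energyCoeff f k := by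
  rw [continuous_iff_continuousAt]
  intro g
  rw [ContinuousAt, tendsto_iff_norm_sub_tendsto_zero]
  have h : Filter.Tendsto (fun f : L2Field L => (area L)⁻¹ * (‖f - g‖ * (‖f‖ + ‖g‖) / 2))
      (nhds g) (nhds ((area L)⁻¹ * (‖g - g‖ * (‖g‖ + ‖g‖) / 2))) :=
    Continuous.tendsto (by fun_prop) g
  simp only [sub_self, norm_zero, zero_mul, zero_div, mul_zero] at h
  exact squeeze_zero (fun _ => norm_nonneg _) (fun f => norm_energyCoeff_sub_le f g k) h

/-- The Fourier coefficients of the square of a component are given by a convolution. -/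
lemma hasSum_coeff_component_sq (f : L2Field L) (i : Fin 2) (k : Fin 2 → ℤ) :
    HasSum (fun j => conj (fieldCoeff f j i) * fieldCoeff f (j + k) i)
      (coeff L (fun x => ((f x i ^ 2 : ℝ) : ℂ)) k) := by
  have hm : MemLp (fun x => char L (-k) x * ((f x i : ℝ) : ℂ)) 2 volume := by
    refine (memLp_component f i).of_le ((char L (-k)).continuous.aestronglyMeasurable.mul
      (memLp_component f i).aestronglyMeasurable) (ae_of_all _ fun x => ?_)
    rw [norm_mul, norm_char_apply, one_mul]
  have h := hasSum_conj_coeff_mul_coeff (memLp_component f i) hm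
  simp only [coeff_char_mul, sub_neg_eq_add, Complex.conj_ofReal] at h
  suffices e : coeff L (fun x => ((f x i ^ 2 : ℝ) : ℂ)) k = ((area L : ℝ) : ℂ)⁻¹ *
      ∫ x, ((f x i : ℝ) : ℂ) * (char L (-k) x * ((f x i : ℝ) : ℂ)) by
    rw [e]; exact h
  rw [coeff_eq]
  congr 2
  ext x
  push_cast
  ring

lemma energyCoeff_eq_sum (f : L2Field L) (k : Fin 2 → ℤ) :
    energyCoeff f k = ∑ i, coeff L (fun x => ((f x i ^ 2 : ℝ) : ℂ)) k / 2 := by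
  have hi : ∀ i, Integrable (fun x => ((f x i ^ 2 : ℝ) : ℂ)) (volume : Measure (Torus L)) :=
    fun i => by
      have h := (memLp_component f i).integrable_norm_pow (p := 2) (by norm_num)
      simp only [Complex.norm_real, Real.norm_eq_abs, sq_abs] at h
      exact h.ofReal
  rw [Fin.sum_univ_two, ← add_div, ← coeff_add (hi 0) (hi 1), div_eq_inv_mul, ← coeff_const_mul,
    energyCoeff]
  congr 1
  ext x
  rw [EuclideanSpace.real_norm_sq_eq, Fin.sum_univ_two]
  push_cast
  ring

/-- For a submultiplicative weight `w`, the weighted `ℓ^∞` norm of the coefficients of `|f|² / 2`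
is controlled by the weighted `ℓ²` norm of the coefficients of `f`. -/
lemma weight_mul_norm_energyCoeff_le {f : L2Field L} {w : (Fin 2 → ℤ) → ℝ} (hw : ∀ k, 0 ≤ w k)
    (hsub : ∀ j k, w k ≤ w j * w (j + k)) {N : ℝ}
    (hN : ∀ F : Finset (Fin 2 → ℤ), ∑ k ∈ F, ∑ i, (w k * ‖fieldCoeff f k i‖) ^ 2 ≤ N)
    (k : Fin 2 → ℤ) : w k * ‖energyCoeff f k‖ ≤ N / 2 := by
  set a : Fin 2 → (Fin 2 → ℤ) → ℝ := fun i j => (w j * ‖fieldCoeff f j i‖) ^ 2 with ha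
  have hs : Summable fun j => ∑ i, a i j :=
    summable_of_sum_le (fun j => Finset.sum_nonneg fun i _ => sq_nonneg _) hN
  have hsi : ∀ i, Summable (a i) := fun i =>
    hs.of_nonneg_of_le (fun j => sq_nonneg _) fun j =>
      Finset.single_le_sum (f := fun i => a i j) (fun i _ => sq_nonneg _) (Finset.mem_univ i)
  have hle : ∑ i, ∑' j, a i j ≤ N := by
    rw [← Summable.tsum_finsetSum fun i _ => hsi i]
    exact hs.tsum_le_of_sum_le hN
  have hi : ∀ i, w k * ‖coeff L (fun x => ((f x i ^ 2 : ℝ) : ℂ)) k‖ ≤ ∑' j, a i j := by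
    intro i
    have h1 := hasSum_coeff_component_sq f i k
    have hshift : HasSum (fun j => a i (j + k)) (∑' j, a i j) :=
      (Equiv.addRight k).hasSum_iff.mpr (hsi i).hasSum
    have h2 := ((hsi i).hasSum.add hshift).mul_left (2⁻¹ : ℝ)
    have h3 : ∀ j, ‖(w k : ℂ) * (conj (fieldCoeff f j i) * fieldCoeff f (j + k) i)‖
        ≤ 2⁻¹ * (a i j + a i (j + k)) := by
      intro j
      rw [norm_mul, norm_mul, RCLike.norm_conj, Complex.norm_real, Real.norm_of_nonneg (hw k)]
      have h4 : w k * (‖fieldCoeff f j i‖ * ‖fieldCoeff f (j + k) i‖)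
          ≤ (w j * w (j + k)) * (‖fieldCoeff f j i‖ * ‖fieldCoeff f (j + k) i‖) :=
        mul_le_mul_of_nonneg_right (hsub j k) (by positivity)
      have h5 := sq_nonneg (w j * ‖fieldCoeff f j i‖ - w (j + k) * ‖fieldCoeff f (j + k) i‖)
      simp only [ha]
      nlinarith
    have h4 := tsum_of_norm_bounded h2 h3
    rw [(h1.mul_left (w k : ℂ)).tsum_eq, norm_mul, Complex.norm_real,
      Real.norm_of_nonneg (hw k)] at h4
    linarith
  have h0 : ‖energyCoeff f k‖ ≤ ∑ i, ‖coeff L (fun x => ((f x i ^ 2 : ℝ) : ℂ)) k‖ / 2 := by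
    rw [energyCoeff_eq_sum]
    refine (norm_sum_le _ _).trans_eq ?_
    simp
  calc w k * ‖energyCoeff f k‖
      ≤ w k * ∑ i, ‖coeff L (fun x => ((f x i ^ 2 : ℝ) : ℂ)) k‖ / 2 :=
        mul_le_mul_of_nonneg_left h0 (hw k)
    _ = (∑ i, w k * ‖coeff L (fun x => ((f x i ^ 2 : ℝ) : ℂ)) k‖) / 2 := by
        rw [Finset.mul_sum, Finset.sum_div]
        simp only [mul_div_assoc]
    _ ≤ N / 2 := by
        have := Finset.sum_le_sum fun i (_ : i ∈ Finset.univ) => hi i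
        linarith

end Fields

/-! ### Wave vectors and the symbol -/

section Kernel

variable (L : Fin 2 → ℝ)

/-- The Euclidean length of the wave vector. -/
def waveNorm (k : Fin 2 → ℤ) : ℝ := √(waveSq L k)

lemma waveSq_nonneg (k : Fin 2 → ℤ) : 0 ≤ waveSq L k := Finset.sum_nonneg fun _ _ => sq_nonneg _

lemma waveNorm_nonneg (k : Fin 2 → ℤ) : 0 ≤ waveNorm L k := Real.sqrt_nonneg _

lemma waveNorm_sq (k : Fin 2 → ℤ) : waveNorm L k ^ 2 = waveSq L k :=
  Real.sq_sqrt (waveSq_nonneg L k)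

lemma symbol_eq (k : Fin 2 → ℤ) : symbol L k = waveNorm L k ^ 4 - waveNorm L k ^ 2 := by
  rw [symbol, ← waveNorm_sq]; ring

lemma abs_wave_le (k : Fin 2 → ℤ) (i : Fin 2) : |wave L k i| ≤ waveNorm L k := by
  rw [← Real.sqrt_sq_eq_abs]
  exact Real.sqrt_le_sqrt
    (Finset.single_le_sum (f := fun i => wave L k i ^ 2) (fun i _ => sq_nonneg _)
      (Finset.mem_univ i))

lemma wave_neg (k : Fin 2 → ℤ) (i : Fin 2) : wave L (-k) i = -wave L k i := by
  simp only [wave, Pi.neg_apply, Int.cast_neg]; ring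

lemma wave_add (j k : Fin 2 → ℤ) (i : Fin 2) : wave L (j + k) i = wave L j i + wave L k i := by
  simp only [wave, Pi.add_apply, Int.cast_add]; ring

lemma symbol_neg (k : Fin 2 → ℤ) : symbol L (-k) = symbol L k := by
  simp only [symbol, waveSq, wave_neg, neg_sq]

lemma waveNorm_eq (k : Fin 2 → ℤ) : waveNorm L k = ‖(WithLp.toLp 2 (wave L k) : Vec)‖ := by
  rw [EuclideanSpace.norm_eq, waveNorm, waveSq]
  simp only [Real.norm_eq_abs, sq_abs]

lemma waveNorm_le_add (j k : Fin 2 → ℤ) :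
    waveNorm L k ≤ waveNorm L j + waveNorm L (j + k) := by
  have h : (WithLp.toLp 2 (wave L k) : Vec)
      = WithLp.toLp 2 (wave L (j + k)) - WithLp.toLp 2 (wave L j) := by
    ext i
    simp [wave_add]
  rw [waveNorm_eq L k, waveNorm_eq L j, waveNorm_eq L (j + k), h, add_comm ‖_‖]
  exact norm_sub_le (E := Vec) _ _

lemma neg_symbol_le_quarter (k : Fin 2 → ℤ) : -symbol L k ≤ 1 / 4 := by
  rw [symbol]; nlinarith [sq_nonneg (waveSq L k - 1 / 2)]

lemma neg_symbol_le (k : Fin 2 → ℤ) : -symbol L k ≤ growthRate L :=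
  le_ciSup (f := fun k => -symbol L k)
    ⟨1 / 4, by rintro _ ⟨k, rfl⟩; exact neg_symbol_le_quarter L k⟩ k

lemma growthRate_nonneg : 0 ≤ growthRate L := by
  have h := neg_symbol_le L 0
  have : symbol L 0 = 0 := by simp [symbol, waveSq, wave]
  linarith

lemma growthRate_le : growthRate L ≤ 1 / 4 := ciSup_le fun k => neg_symbol_le_quarter L k

lemma exp_neg_mul_symbol_le {t : ℝ} (ht : 0 ≤ t) (k : Fin 2 → ℤ) :
    Real.exp (-t * symbol L k) ≤ Real.exp (growthRate L * t) := by
  apply Real.exp_le_exp.mpr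
  nlinarith [neg_symbol_le L k]

/-! ### Parabolic smoothing of Fourier modes -/

/-- The parabolic length scale `min (1, t^{1/4})`. -/
def scale (t : ℝ) : ℝ := min 1 (t ^ (1 / 4 : ℝ))

lemma scale_le_one (t : ℝ) : scale t ≤ 1 := min_le_left _ _

lemma scale_nonneg {t : ℝ} (ht : 0 ≤ t) : 0 ≤ scale t :=
  le_min zero_le_one (Real.rpow_nonneg ht _)

lemma scale_pos {t : ℝ} (ht : 0 < t) : 0 < scale t :=
  lt_min one_pos (Real.rpow_pos_of_pos ht _)

lemma scale_mono {s t : ℝ} (hs : 0 ≤ s) (hst : s ≤ t) : scale s ≤ scale t :=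
  min_le_min_left _ (Real.rpow_le_rpow hs hst (by norm_num))

lemma scale_pow_four_le {t : ℝ} (ht : 0 ≤ t) : scale t ^ 4 ≤ t := by
  have h : scale t ^ 4 ≤ (t ^ (1 / 4 : ℝ)) ^ 4 :=
    pow_le_pow_left₀ (scale_nonneg ht) (min_le_right _ _) 4
  rwa [← Real.rpow_natCast, ← Real.rpow_natCast, ← Real.rpow_mul ht, Nat.cast_ofNat,
    show (1 / 4 * 4 : ℝ) = 1 by norm_num, Real.rpow_one, Real.rpow_ofNat] at h

/-- The scale is subadditive: `t^{1/4}` is concave. -/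
lemma scale_le_add {s t : ℝ} (hs : 0 ≤ s) (hst : s ≤ t) : scale t ≤ scale s + scale (t - s) := by
  have h1 : 0 ≤ t - s := sub_nonneg.mpr hst
  have h2 := scale_nonneg hs
  have h3 := scale_nonneg h1
  rcases le_total 1 (s ^ (1 / 4 : ℝ)) with h | h
  · have : scale s = 1 := min_eq_left h
    linarith [scale_le_one t]
  rcases le_total 1 ((t - s) ^ (1 / 4 : ℝ)) with h' | h'
  · have : scale (t - s) = 1 := min_eq_left h'
    linarith [scale_le_one t]
  have h4 : scale s = s ^ (1 / 4 : ℝ) := min_eq_right h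
  have h5 : scale (t - s) = (t - s) ^ (1 / 4 : ℝ) := min_eq_right h'
  rw [h4, h5]
  have h6 := Real.rpow_add_le_add_rpow hs h1 (p := 1 / 4) (by norm_num) (by norm_num)
  rw [add_sub_cancel] at h6
  exact (min_le_right _ _).trans h6

lemma inv_scale_pow_le {t : ℝ} (ht : 0 < t) (n : ℕ) :
    (scale t ^ n)⁻¹ ≤ 1 + t ^ (-(n / 4 : ℝ)) := by
  have h0 : 0 ≤ t ^ (-(n / 4 : ℝ)) := Real.rpow_nonneg ht.le _
  rcases le_total 1 (t ^ (1 / 4 : ℝ)) with h | h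
  · rw [scale, min_eq_left h, one_pow, inv_one]
    linarith
  · rw [scale, min_eq_right h, ← Real.rpow_natCast, ← Real.rpow_mul ht.le,
      ← Real.rpow_neg ht.le, show -(1 / 4 * (n : ℝ)) = -(n / 4 : ℝ) by ring]
    linarith

/-- A single mode: the fourth-order dissipation dominates the growth of the long waves and an
exponential weight at the parabolic scale, with room for an algebraic gain. -/
lemma exp_symbol_mul_exp_scale_le {t : ℝ} (ht : 0 ≤ t) (k : Fin 2 → ℤ) :
    Real.exp (-t * symbol L k) * Real.exp (scale t * waveNorm L k) *
      (1 + scale t * waveNorm L k) ^ 3 ≤ Real.exp 6 * Real.exp (growthRate L * t) := by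
  set q := scale t with hq
  set n := waveNorm L k with hn
  have hq0 : 0 ≤ q := scale_nonneg ht
  have hq1 : q ≤ 1 := scale_le_one t
  have hn0 : 0 ≤ n := waveNorm_nonneg L k
  have hx0 : 0 ≤ q * n := by positivity
  have h1 : (1 + q * n) ^ 3 ≤ Real.exp (3 * (q * n)) := by
    have := pow_le_pow_left₀ (by positivity) (Real.add_one_le_exp (q * n)) 3
    rw [← Real.exp_nat_mul] at this
    rw [add_comm]
    exact_mod_cast this
  refine (mul_le_mul_of_nonneg_left h1 (by positivity)).trans ?_
  rw [← Real.exp_add, ← Real.exp_add, ← Real.exp_add]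
  apply Real.exp_le_exp.mpr
  have h2 : q ^ 4 ≤ t := scale_pow_four_le ht
  have h3 : -symbol L k ≤ growthRate L := neg_symbol_le L k
  have h4 : (t - q ^ 4) * (-symbol L k) ≤ (t - q ^ 4) * growthRate L :=
    mul_le_mul_of_nonneg_left h3 (by linarith)
  have h5 : 0 ≤ q ^ 4 * growthRate L := mul_nonneg (by positivity) (growthRate_nonneg L)
  have h6 : q ^ 4 * symbol L k = (q * n) ^ 4 - q ^ 2 * (q * n) ^ 2 := by rw [symbol_eq]; ring
  have h7 : q ^ 2 * (q * n) ^ 2 ≤ (q * n) ^ 2 :=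
    mul_le_of_le_one_left (by positivity) (pow_le_one₀ hq0 hq1)
  nlinarith [sq_nonneg ((q * n) ^ 2 - 3 / 2), sq_nonneg (q * n - 1)]

/-- A pointwise bound on the symbol of `exp (-t (Δ² + Δ)) ∇` which is integrable in `t` near `0`
and square-summable over the modes. -/
lemma waveNorm_mul_exp_le {t : ℝ} (ht : 0 < t) (k : Fin 2 → ℤ) :
    waveNorm L k * Real.exp (-t * symbol L k) ≤
      Real.exp 6 * Real.exp (growthRate L * t) * (scale t ^ 3)⁻¹ *
        ((1 + waveNorm L k) ^ 2)⁻¹ := by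
  have h1 := exp_symbol_mul_exp_scale_le L ht.le k
  have hq0 : 0 < scale t := scale_pos ht
  have hq1 := scale_le_one t
  have hn := waveNorm_nonneg L k
  set q := scale t
  set n := waveNorm L k
  set M := Real.exp 6 * Real.exp (growthRate L * t) with hM
  rw [mul_assoc M, ← mul_inv, ← div_eq_mul_inv, le_div_iff₀ (by positivity)]
  have h2 : q * (1 + n) ≤ 1 + q * n := by linarith
  calc n * Real.exp (-t * symbol L k) * (q ^ 3 * (1 + n) ^ 2)
      ≤ (1 + n) * Real.exp (-t * symbol L k) * (q ^ 3 * (1 + n) ^ 2) := by gcongr; linarith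
    _ = Real.exp (-t * symbol L k) * 1 * (q * (1 + n)) ^ 3 := by ring
    _ ≤ Real.exp (-t * symbol L k) * Real.exp (q * n) * (1 + q * n) ^ 3 := by
        gcongr
        exact Real.one_le_exp (by positivity)
    _ ≤ M := h1

/-! ### Lattice sums -/

lemma sum_range_inv_sq_le {a : ℝ} (ha : 0 < a) (N : ℕ) :
    ∑ n ∈ Finset.range N, ((1 + a * (n : ℝ)) ^ 2)⁻¹ ≤ 1 + a⁻¹ := by
  have h : ∀ N : ℕ, ∑ n ∈ Finset.range (N + 1), ((1 + a * (n : ℝ)) ^ 2)⁻¹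
      ≤ 1 + a⁻¹ * (1 - (1 + a * (N : ℝ))⁻¹) := by
    intro N
    induction N with
    | zero => simp
    | succ N ih =>
      rw [Finset.sum_range_succ]
      have h1 : ((1 + a * ((N + 1 : ℕ) : ℝ)) ^ 2)⁻¹
          ≤ a⁻¹ * ((1 + a * (N : ℝ))⁻¹ - (1 + a * ((N + 1 : ℕ) : ℝ))⁻¹) := by
        have hN : (0 : ℝ) ≤ N := N.cast_nonneg
        have e1 : 0 < 1 + a * (N : ℝ) := by positivity
        have e2 : 0 < 1 + a * ((N + 1 : ℕ) : ℝ) := by positivity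
        have e3 : a⁻¹ * ((1 + a * (N : ℝ))⁻¹ - (1 + a * ((N + 1 : ℕ) : ℝ))⁻¹)
            = ((1 + a * (N : ℝ)) * (1 + a * ((N + 1 : ℕ) : ℝ)))⁻¹ := by
          push_cast at e2 ⊢
          field_simp
          ring
        rw [e3, sq]
        apply inv_anti₀ (by positivity)
        apply mul_le_mul_of_nonneg_right _ e2.le
        push_cast
        nlinarith
      linarith
  have h2 := Finset.sum_le_sum_of_subset_of_nonneg (Finset.range_mono (Nat.le_succ N))
    fun n _ _ => (by positivity : (0 : ℝ) ≤ ((1 + a * (n : ℝ)) ^ 2)⁻¹)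
  have h3 : 0 ≤ a⁻¹ * (1 + a * (N : ℝ))⁻¹ := by positivity
  linarith [h N]

lemma sum_int_inv_sq_le {a : ℝ} (ha : 0 < a) (S : Finset ℤ) :
    ∑ n ∈ S, ((1 + a * |(n : ℝ)|) ^ 2)⁻¹ ≤ 1 + 2 * a⁻¹ := by
  have hs : Summable fun n : ℕ => ((1 + a * (n : ℝ)) ^ 2)⁻¹ :=
    summable_of_sum_range_le (fun n => by positivity) (sum_range_inv_sq_le ha)
  have hle := hs.tsum_le_of_sum_range_le (sum_range_inv_sq_le ha)
  have h := HasSum.of_nat_of_neg (f := fun n : ℤ => ((1 + a * |(n : ℝ)|) ^ 2)⁻¹)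
    (by simpa using hs.hasSum) (by simpa using hs.hasSum)
  have h1 := h.summable.sum_le_tsum S fun n _ => by positivity
  rw [h.tsum_eq] at h1
  simp only [Int.cast_zero, abs_zero, mul_zero, add_zero, one_pow, inv_one] at h1
  linarith

variable [∀ i, Fact (0 < L i)]

/-- A constant for the sum of `(1 + q |k|)⁻⁴` over the dual lattice. -/
def latticeConst : ℝ := ∏ i, (1 + L i / Real.pi)

lemma latticeConst_pos : 0 < latticeConst L :=
  Finset.prod_pos fun i _ => by have := period_pos L i; positivity

/-- The lattice sum of `(1 + q |k|)⁻⁴` is `O(q⁻²)`, as is the integral over the plane. -/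
lemma sum_inv_pow_four_le {q : ℝ} (hq : 0 < q) (hq1 : q ≤ 1) (F : Finset (Fin 2 → ℤ)) :
    ∑ k ∈ F, ((1 + q * waveNorm L k) ^ 4)⁻¹ ≤ latticeConst L / q ^ 2 := by
  set g : Fin 2 → ℤ → ℝ := fun i n => ((1 + q * (2 * Real.pi / L i) * |(n : ℝ)|) ^ 2)⁻¹ with hg
  have hg0 : ∀ i n, 0 ≤ g i n := fun i n => by simp only [hg]; positivity
  have hpt : ∀ k, ((1 + q * waveNorm L k) ^ 4)⁻¹ ≤ ∏ i, g i (k i) := by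
    intro k
    have hi : ∀ i, 1 + q * (2 * Real.pi / L i) * |((k i : ℤ) : ℝ)| ≤ 1 + q * waveNorm L k := by
      intro i
      have hL := period_pos L i
      have h1 : |wave L k i| = (2 * Real.pi / L i) * |((k i : ℤ) : ℝ)| := by
        rw [wave, abs_div, abs_mul, abs_of_pos hL, abs_of_pos Real.two_pi_pos]
        ring
      have h2 := mul_le_mul_of_nonneg_left (abs_wave_le L k i) hq.le
      rw [h1] at h2
      linarith
    have hp : ∀ i, 0 < 1 + q * (2 * Real.pi / L i) * |((k i : ℤ) : ℝ)| := fun i => by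
      have hL := period_pos L i
      positivity
    rw [Fin.prod_univ_two]
    simp only [hg]
    rw [← mul_inv]
    apply inv_anti₀ (mul_pos (pow_pos (hp 0) 2) (pow_pos (hp 1) 2))
    calc _ ≤ (1 + q * waveNorm L k) ^ 2 * (1 + q * waveNorm L k) ^ 2 :=
          mul_le_mul (pow_le_pow_left₀ (hp 0).le (hi 0) 2) (pow_le_pow_left₀ (hp 1).le (hi 1) 2)
            (by positivity) (by positivity)
      _ = _ := by ring
  have hone : ∀ i, ∀ S : Finset ℤ, ∑ n ∈ S, g i n ≤ (1 + L i / Real.pi) / q := by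
    intro i S
    have hL := period_pos L i
    refine (sum_int_inv_sq_le (a := q * (2 * Real.pi / L i)) (by positivity) S).trans ?_
    have e : 1 + 2 * (q * (2 * Real.pi / L i))⁻¹ = 1 + L i / Real.pi / q := by
      field_simp
    rw [e, add_div]
    gcongr
    exact (one_le_inv₀ hq).mpr hq1 |>.trans_eq (by ring)
  calc ∑ k ∈ F, ((1 + q * waveNorm L k) ^ 4)⁻¹ ≤ ∑ k ∈ F, ∏ i, g i (k i) :=
        Finset.sum_le_sum fun k _ => hpt k
    _ ≤ ∑ k ∈ Fintype.piFinset fun i => F.image fun k => k i, ∏ i, g i (k i) := by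
        refine Finset.sum_le_sum_of_subset_of_nonneg (fun k hk => ?_)
          fun k _ _ => Finset.prod_nonneg fun i _ => hg0 _ _
        exact Fintype.mem_piFinset.mpr fun i => Finset.mem_image_of_mem _ hk
    _ = ∏ i, ∑ n ∈ F.image fun k => k i, g i n := (Finset.prod_univ_sum _ _).symm
    _ ≤ ∏ i, (1 + L i / Real.pi) / q :=
        Finset.prod_le_prod (fun i _ => Finset.sum_nonneg fun n _ => hg0 _ _)
          fun i _ => hone i _
    _ = latticeConst L / q ^ 2 := by
        rw [Finset.prod_div_distrib, latticeConst, Finset.prod_const, Finset.card_univ,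
          Fintype.card_fin]

lemma summable_inv_pow_four {q : ℝ} (hq : 0 < q) (hq1 : q ≤ 1) :
    Summable fun k => ((1 + q * waveNorm L k) ^ 4)⁻¹ :=
  summable_of_sum_le (fun k => inv_nonneg.mpr (by positivity)) (sum_inv_pow_four_le L hq hq1)

/-- The constant in the smoothing estimate for `exp (-t (Δ² + Δ)) ∇`. -/
def smoothConst : ℝ := Real.exp 6 * √(latticeConst L)

lemma smoothConst_pos : 0 < smoothConst L :=
  mul_pos (Real.exp_pos _) (Real.sqrt_pos.mpr (latticeConst_pos L))

/-- The `ℓ²` norm of the symbol of `exp (-t (Δ² + Δ)) ∇`, with an exponential weight at the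
parabolic scale, is `O(e^{μ t} (1 + t^{-1/2}))`. -/
lemma sum_sq_kernel_le {t : ℝ} (ht : 0 < t) (F : Finset (Fin 2 → ℤ)) :
    ∑ k ∈ F, (waveNorm L k *
      (Real.exp (-t * symbol L k) * Real.exp (scale t * waveNorm L k))) ^ 2
      ≤ (smoothConst L * Real.exp (growthRate L * t) * (1 + t ^ (-(1 / 2) : ℝ))) ^ 2 := by
  set q := scale t with hq
  have hq0 : 0 < q := scale_pos ht
  set M := Real.exp 6 * Real.exp (growthRate L * t) with hM
  have hM0 : 0 < M := by positivity
  have hpt : ∀ k, (waveNorm L k *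
      (Real.exp (-t * symbol L k) * Real.exp (q * waveNorm L k))) ^ 2
      ≤ M ^ 2 / q ^ 2 * ((1 + q * waveNorm L k) ^ 4)⁻¹ := by
    intro k
    have h1 := exp_symbol_mul_exp_scale_le L ht.le k
    rw [← hq, ← hM] at h1
    have hn := waveNorm_nonneg L k
    set n := waveNorm L k
    set e := Real.exp (-t * symbol L k) * Real.exp (q * n) with he
    have he0 : 0 ≤ e := by positivity
    have h2 : q * (n * e) * (1 + q * n) ^ 2 ≤ M :=
      calc q * (n * e) * (1 + q * n) ^ 2 = e * (1 + q * n) ^ 2 * (q * n) := by ring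
        _ ≤ e * (1 + q * n) ^ 2 * (1 + q * n) :=
            mul_le_mul_of_nonneg_left (by linarith) (by positivity)
        _ = e * (1 + q * n) ^ 3 := by ring
        _ ≤ M := h1
    have h3 := pow_le_pow_left₀ (by positivity) h2 2
    rw [div_mul_eq_mul_div, ← div_eq_mul_inv, div_div, le_div_iff₀ (by positivity)]
    calc _ = (q * (n * e) * (1 + q * n) ^ 2) ^ 2 := by ring
      _ ≤ M ^ 2 := h3
  calc _ ≤ ∑ k ∈ F, M ^ 2 / q ^ 2 * ((1 + q * waveNorm L k) ^ 4)⁻¹ :=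
        Finset.sum_le_sum fun k _ => hpt k
    _ ≤ M ^ 2 / q ^ 2 * (latticeConst L / q ^ 2) := by
        rw [← Finset.mul_sum]
        exact mul_le_mul_of_nonneg_left (sum_inv_pow_four_le L hq0 (scale_le_one t) F)
          (by positivity)
    _ = (smoothConst L * Real.exp (growthRate L * t) * (q ^ 2)⁻¹) ^ 2 := by
        have := Real.sq_sqrt (latticeConst_pos L).le
        rw [smoothConst, mul_pow, mul_pow, mul_pow, mul_pow, this]
        field_simp
    _ ≤ _ := by
        have h1 := inv_scale_pow_le ht 2
        rw [show (-(((2 : ℕ) : ℝ) / 4) : ℝ) = -(1 / 2) by norm_num] at h1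
        have := (smoothConst_pos L).le
        gcongr

lemma summable_inv_sq_sq : Summable fun k => (((1 + waveNorm L k) ^ 2)⁻¹) ^ 2 := by
  have := summable_inv_pow_four L one_pos le_rfl
  refine this.congr fun k => ?_
  rw [one_mul, inv_pow, ← pow_mul]

end Kernel

/-! ### Gevrey norms -/

section Gevrey

variable {L : Fin 2 → ℝ}

lemma norm_gradMode_le {t : ℝ} (k : Fin 2 → ℤ) (i : Fin 2) (e : ℂ) :
    ‖(Real.exp (-t * symbol L k) : ℂ) * (Complex.I * (wave L k i : ℂ) * e)‖
      ≤ waveNorm L k * Real.exp (-t * symbol L k) * ‖e‖ := by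
  rw [norm_mul, norm_mul, norm_mul, Complex.norm_I, one_mul, Complex.norm_real, Complex.norm_real,
    Real.norm_of_nonneg (Real.exp_pos _).le, Real.norm_eq_abs]
  calc _ = |wave L k i| * Real.exp (-t * symbol L k) * ‖e‖ := by ring
    _ ≤ _ := by gcongr; exact abs_wave_le L k i

variable [∀ i, Fact (0 < L i)]

/-- The weighted `ℓ²` norm of the Fourier coefficients of `f`, with the exponential weight
`exp (r |k|)`, is at most `N`; it is expressed by the finite partial sums. -/
def GevreyBound (r N : ℝ) (f : L2Field L) : Prop :=
  ∀ F : Finset (Fin 2 → ℤ),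
    ∑ k ∈ F, ∑ i, (Real.exp (r * waveNorm L k) * ‖fieldCoeff f k i‖) ^ 2 ≤ N ^ 2

/-- Finitely many weighted Fourier coefficients, as a vector in a Euclidean space. -/
def weightedCoeffL (r : ℝ) (F : Finset (Fin 2 → ℤ)) :
    L2Field L →L[ℝ] EuclideanSpace ℂ (F × Fin 2) :=
  (PiLp.continuousLinearEquiv 2 ℝ (fun _ : F × Fin 2 => ℂ)).symm.toContinuousLinearMap.comp
    (ContinuousLinearMap.pi fun p =>
      Real.exp (r * waveNorm L (p.1 : Fin 2 → ℤ)) • fieldCoeffL (p.1 : Fin 2 → ℤ) p.2)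

lemma norm_weightedCoeffL_sq (r : ℝ) (F : Finset (Fin 2 → ℤ)) (f : L2Field L) :
    ‖weightedCoeffL r F f‖ ^ 2
      = ∑ k ∈ F, ∑ i, (Real.exp (r * waveNorm L k) * ‖fieldCoeff f k i‖) ^ 2 := by
  rw [EuclideanSpace.norm_sq_eq, Fintype.sum_prod_type,
    ← Finset.sum_coe_sort F fun k => ∑ i, (Real.exp (r * waveNorm L k) * ‖fieldCoeff f k i‖) ^ 2]
  refine Finset.sum_congr rfl fun k _ => Finset.sum_congr rfl fun i _ => ?_
  have : weightedCoeffL r F f (k, i)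
      = Real.exp (r * waveNorm L (k : Fin 2 → ℤ)) • fieldCoeff f k i := rfl
  rw [this, norm_smul, Real.norm_of_nonneg (Real.exp_pos _).le]

lemma gevreyBound_iff {r N : ℝ} (hN : 0 ≤ N) {f : L2Field L} :
    GevreyBound r N f ↔ ∀ F, ‖weightedCoeffL r F f‖ ≤ N := by
  refine forall_congr' fun F => ?_
  rw [← norm_weightedCoeffL_sq]
  exact pow_le_pow_iff_left₀ (norm_nonneg _) hN two_ne_zero

lemma isClosed_gevreyBound (r N : ℝ) : IsClosed {f : L2Field L | GevreyBound r N f} := by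
  simp only [GevreyBound, Set.ofPred_forall]
  refine isClosed_iInter fun F => isClosed_le ?_ continuous_const
  simp only [← norm_weightedCoeffL_sq]
  fun_prop

lemma GevreyBound.mono {r r' N N' : ℝ} {f : L2Field L} (h : GevreyBound r N f) (hr : r' ≤ r)
    (hN : 0 ≤ N) (hNN' : N ≤ N') : GevreyBound r' N' f := by
  intro F
  calc _ ≤ ∑ k ∈ F, ∑ i, (Real.exp (r * waveNorm L k) * ‖fieldCoeff f k i‖) ^ 2 := by
        have := waveNorm_nonneg L
        gcongr with k _ i _
        exact this k
    _ ≤ N ^ 2 := h F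
    _ ≤ N' ^ 2 := pow_le_pow_left₀ hN hNN' 2

lemma GevreyBound.sub {r N M : ℝ} {f g : L2Field L} (hf : GevreyBound r N f)
    (hg : GevreyBound r M g) (hN : 0 ≤ N) (hM : 0 ≤ M) : GevreyBound r (N + M) (f - g) := by
  rw [gevreyBound_iff hN] at hf
  rw [gevreyBound_iff hM] at hg
  rw [gevreyBound_iff (add_nonneg hN hM)]
  intro F
  rw [map_sub]
  exact (norm_sub_le _ _).trans (add_le_add (hf F) (hg F))

lemma GevreyBound.norm_le {r N : ℝ} {f : L2Field L} (h : GevreyBound r N f) (hr : 0 ≤ r)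
    (hN : 0 ≤ N) : ‖f‖ ≤ √(area L) * N := by
  have h0 := h.mono hr hN le_rfl
  simp only [GevreyBound, zero_mul, Real.exp_zero, one_mul] at h0
  have h1 := (hasSum_norm_fieldCoeff_sq f).summable.tsum_le_of_sum_le h0
  rw [(hasSum_norm_fieldCoeff_sq f).tsum_eq, inv_mul_le_iff₀ (area_pos L)] at h1
  refine le_of_sq_le_sq ?_ (by positivity)
  rwa [mul_pow, Real.sq_sqrt (area_pos L).le]

lemma integral_one_add_rpow {a t r : ℝ} (hr : -1 < r) :
    IntervalIntegrable (fun τ => 1 + (t - τ) ^ r) volume a t ∧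
      ∫ τ in a..t, (1 + (t - τ) ^ r) = (t - a) + (t - a) ^ (r + 1) / (r + 1) := by
  have h : ∀ b c : ℝ, IntervalIntegrable (fun s : ℝ => 1 + s ^ r) volume b c := fun b c =>
    intervalIntegrable_const.add (intervalIntegral.intervalIntegrable_rpow' hr)
  constructor
  · have := (h (t - a) (t - t)).comp_sub_left t
    simpa using this
  · rw [intervalIntegral.integral_comp_sub_left (fun s : ℝ => 1 + s ^ r) t, sub_self,
      intervalIntegral.integral_add intervalIntegrable_const
        (intervalIntegral.intervalIntegrable_rpow' hr), integral_rpow (Or.inl hr),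
      Real.zero_rpow (by linarith)]
    simp

/-- An integral with an integrable singularity at its upper endpoint, where `f` is not controlled. -/
lemma norm_integral_singular_le {E : Type*} [NormedAddCommGroup E] [NormedSpace ℝ E] {f : ℝ → E}
    {a t c r : ℝ} (hat : a ≤ t) (hr : -1 < r)
    (hf : ∀ τ ∈ Set.Ico a t, ‖f τ‖ ≤ c * (1 + (t - τ) ^ r)) :
    ‖∫ τ in a..t, f τ‖ ≤ c * ((t - a) + (t - a) ^ (r + 1) / (r + 1)) := by
  obtain ⟨h1, h2⟩ := integral_one_add_rpow (a := a) (t := t) hr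
  rw [← h2, ← intervalIntegral.integral_const_mul]
  refine intervalIntegral.norm_integral_le_of_norm_le hat ?_ (h1.const_mul c)
  filter_upwards [compl_mem_ae_iff.mpr (measure_singleton t)] with τ hτ hτ'
  exact hf τ ⟨hτ'.1.le, lt_of_le_of_ne hτ'.2 hτ⟩

/-- Minkowski's integral inequality for the Gevrey norms. -/
lemma gevreyBound_integral {r c s t : ℝ} (ht : 0 ≤ t) (hs : -1 < s) (hc : 0 ≤ c)
    {f : ℝ → L2Field L} (hint : IntervalIntegrable f volume 0 t)
    (hf : ∀ τ ∈ Set.Ico 0 t, GevreyBound r (c * (1 + (t - τ) ^ s)) (f τ)) :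
    GevreyBound r (c * (t + t ^ (s + 1) / (s + 1))) (∫ τ in (0 : ℝ)..t, f τ) := by
  have hs1 : 0 < s + 1 := by linarith
  have := Real.rpow_nonneg ht (s + 1)
  rw [gevreyBound_iff (by positivity)]
  intro F
  rw [← ContinuousLinearMap.intervalIntegral_comp_comm _ hint]
  have h := norm_integral_singular_le (f := fun τ => weightedCoeffL r F (f τ)) (c := c) ht hs
    fun τ hτ => ?_
  · simpa using h
  · have h0 : 0 ≤ t - τ := by linarith [hτ.2]
    have := Real.rpow_nonneg h0 s
    exact (gevreyBound_iff (by positivity)).mp (hf τ hτ) F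

/-! ### The linear flow -/

lemma fieldCoeff_semigroup {t : ℝ} (ht : 0 ≤ t) (f : L2Field L) (k : Fin 2 → ℤ) (i : Fin 2) :
    fieldCoeff (semigroup L t f) k i = (Real.exp (-t * symbol L k) : ℂ) * fieldCoeff f k i := by
  refine fieldCoeff_invFourier (fun i => ?_) (fun k i => ?_) k i
  · refine ((hasSum_norm_coeff_sq (memLp_component f i)).summable.mul_left
      (Real.exp (growthRate L * t) ^ 2)).of_nonneg_of_le (fun k => sq_nonneg _) fun k => ?_
    rw [norm_mul, Complex.norm_real, Real.norm_of_nonneg (Real.exp_pos _).le, mul_pow]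
    have := exp_neg_mul_symbol_le L ht k
    exact mul_le_mul_of_nonneg_right (pow_le_pow_left₀ (Real.exp_pos _).le this 2) (sq_nonneg _)
  · rw [map_mul, Complex.conj_ofReal, symbol_neg]
    exact congrArg _ (fieldCoeff_neg_index f k i)

lemma norm_fieldCoeff_semigroup {t : ℝ} (ht : 0 ≤ t) (f : L2Field L) (k : Fin 2 → ℤ) (i : Fin 2) :
    ‖fieldCoeff (semigroup L t f) k i‖ = Real.exp (-t * symbol L k) * ‖fieldCoeff f k i‖ := by
  rw [fieldCoeff_semigroup ht, norm_mul, Complex.norm_real,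
    Real.norm_of_nonneg (Real.exp_pos _).le]

lemma gevreyBound_semigroup {t : ℝ} (ht : 0 ≤ t) (f : L2Field L) :
    GevreyBound (scale t)
      (Real.exp 6 * Real.exp (growthRate L * t) * ((√(area L))⁻¹ * ‖f‖)) (semigroup L t f) := by
  intro F
  set M := Real.exp 6 * Real.exp (growthRate L * t) with hM
  have hpt : ∀ k, Real.exp (scale t * waveNorm L k) * Real.exp (-t * symbol L k) ≤ M := by
    intro k
    refine le_trans ?_ (exp_symbol_mul_exp_scale_le L ht k)
    rw [mul_comm]
    refine le_mul_of_one_le_right (by positivity) (one_le_pow₀ ?_)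
    have := mul_nonneg (scale_nonneg ht) (waveNorm_nonneg L k)
    linarith
  calc _ ≤ ∑ k ∈ F, ∑ i, M ^ 2 * ‖fieldCoeff f k i‖ ^ 2 := by
        refine Finset.sum_le_sum fun k _ => Finset.sum_le_sum fun i _ => ?_
        rw [norm_fieldCoeff_semigroup ht, ← mul_assoc, mul_pow]
        have := hpt k
        gcongr
    _ = M ^ 2 * ∑ k ∈ F, ∑ i, ‖fieldCoeff f k i‖ ^ 2 := by simp only [Finset.mul_sum]
    _ ≤ M ^ 2 * ((area L)⁻¹ * ‖f‖ ^ 2) := by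
        have h := hasSum_norm_fieldCoeff_sq f
        rw [← h.tsum_eq]
        gcongr
        exact h.summable.sum_le_tsum F fun k _ => Finset.sum_nonneg fun i _ => sq_nonneg _
    _ = _ := by
        rw [mul_pow M, mul_pow _ ‖f‖, inv_pow, Real.sq_sqrt (area_pos L).le]

lemma continuousOn_semigroup (f : L2Field L) (T : ℝ) :
    ContinuousOn (fun t => semigroup L t f) (Set.Icc 0 T) := by
  refine continuousOn_of_fieldCoeff
    (b := fun k => Real.exp (growthRate L * T) * √(∑ i, ‖fieldCoeff f k i‖ ^ 2)) ?_ ?_ ?_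
  · refine ((hasSum_norm_fieldCoeff_sq f).summable.mul_left
      (Real.exp (growthRate L * T) ^ 2)).congr fun k => ?_
    rw [mul_pow, Real.sq_sqrt (Finset.sum_nonneg fun i _ => sq_nonneg _)]
  · intro k i
    have : Set.EqOn (fun t => fieldCoeff (semigroup L t f) k i)
        (fun t => (Real.exp (-t * symbol L k) : ℂ) * fieldCoeff f k i) (Set.Icc 0 T) :=
      fun t ht => fieldCoeff_semigroup ht.1 f k i
    exact ContinuousOn.congr (by fun_prop) this
  · intro t ht k i
    rw [norm_fieldCoeff_semigroup ht.1]
    refine mul_le_mul ((exp_neg_mul_symbol_le L ht.1 k).trans ?_) ?_ (norm_nonneg _)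
      (Real.exp_pos _).le
    · exact Real.exp_le_exp.mpr (mul_le_mul_of_nonneg_left ht.2 (growthRate_nonneg L))
    · apply Real.le_sqrt_of_sq_le
      exact Finset.single_le_sum (f := fun i => ‖fieldCoeff f k i‖ ^ 2)
        (fun i _ => sq_nonneg _) (Finset.mem_univ i)

/-! ### The smoothed nonlinearity -/

/-- The integrand `exp (-t (Δ² + Δ)) ∇ (|u|² / 2)` of Duhamel's formula. -/
def gradFlow (t : ℝ) (u : L2Field L) : L2Field L := semigroupGrad L t fun x => ‖u x‖ ^ 2 / 2

/-- The factor by which `exp (-t (Δ² + Δ)) ∇` maps the sup norm of Fourier coefficients to their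
`ℓ²` norm. -/
def smoothFactor (L : Fin 2 → ℝ) [∀ i, Fact (0 < L i)] (t : ℝ) : ℝ :=
  smoothConst L * Real.exp (growthRate L * t) * (1 + t ^ (-(1 / 2) : ℝ))

lemma smoothFactor_nonneg {t : ℝ} (ht : 0 ≤ t) : 0 ≤ smoothFactor L t := by
  have := (smoothConst_pos L).le
  have := Real.rpow_nonneg ht (-(1 / 2))
  unfold smoothFactor
  positivity

lemma fieldCoeff_gradFlow {t : ℝ} (ht : 0 < t) (u : L2Field L) (k : Fin 2 → ℤ) (i : Fin 2) :
    fieldCoeff (gradFlow t u) k i =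
      (Real.exp (-t * symbol L k) : ℂ) * (Complex.I * (wave L k i : ℂ) * energyCoeff u k) := by
  refine fieldCoeff_invFourier (a := fun k i => (Real.exp (-t * symbol L k) : ℂ) *
    (Complex.I * (wave L k i : ℂ) * energyCoeff u k)) (fun i => ?_) (fun k i => ?_) k i
  · set M := Real.exp 6 * Real.exp (growthRate L * t) * (scale t ^ 3)⁻¹
    set E := (area L)⁻¹ * (‖u‖ ^ 2 / 2)
    refine ((summable_inv_sq_sq L).mul_left ((M * E) ^ 2)).of_nonneg_of_le
      (fun k => sq_nonneg _) fun k => ?_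
    rw [← mul_pow]
    refine pow_le_pow_left₀ (norm_nonneg _) ((norm_gradMode_le k i _).trans ?_) 2
    rw [mul_right_comm M]
    have := waveNorm_mul_exp_le L ht k
    have h2 := norm_energyCoeff_le u k
    have h3 := mul_nonneg (waveNorm_nonneg L k) (Real.exp_pos (-t * symbol L k)).le
    exact mul_le_mul this h2 (norm_nonneg _) (h3.trans this)
  · rw [symbol_neg, wave_neg, energyCoeff_neg]
    simp only [map_mul, Complex.conj_ofReal, Complex.conj_I, Complex.ofReal_neg]
    ring

/-- The smoothing estimate for `exp (-t (Δ² + Δ)) ∇`, which gains a radius `scale t`. -/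
lemma gevreyBound_of_gradMode {t r r' A : ℝ} (ht : 0 < t) (hr : r ≤ r' + scale t)
    {g : L2Field L} {e : (Fin 2 → ℤ) → ℂ}
    (hg : ∀ k i, fieldCoeff g k i =
      (Real.exp (-t * symbol L k) : ℂ) * (Complex.I * (wave L k i : ℂ) * e k))
    (he : ∀ k, Real.exp (r' * waveNorm L k) * ‖e k‖ ≤ A) :
    GevreyBound r (smoothFactor L t * A) g := by
  intro F
  have hpt : ∀ k, ∑ i, (Real.exp (r * waveNorm L k) * ‖fieldCoeff g k i‖) ^ 2
      ≤ (waveNorm L k * (Real.exp (-t * symbol L k) * Real.exp (scale t * waveNorm L k))) ^ 2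
        * A ^ 2 := by
    intro k
    have h1 : ∀ i, (Real.exp (r * waveNorm L k) * ‖fieldCoeff g k i‖) ^ 2
        = wave L k i ^ 2 *
          (Real.exp (-t * symbol L k) * (Real.exp (r * waveNorm L k) * ‖e k‖)) ^ 2 := by
      intro i
      rw [hg, norm_mul, norm_mul, norm_mul, Complex.norm_I, one_mul, Complex.norm_real,
        Complex.norm_real, Real.norm_of_nonneg (Real.exp_pos _).le, Real.norm_eq_abs,
        ← sq_abs (wave L k i)]
      ring
    simp only [h1]
    rw [← Finset.sum_mul, ← waveSq, ← waveNorm_sq, ← mul_pow, ← mul_pow]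
    have hn := waveNorm_nonneg L k
    have h2 : Real.exp (r * waveNorm L k) * ‖e k‖ ≤ Real.exp (scale t * waveNorm L k) * A :=
      calc Real.exp (r * waveNorm L k) * ‖e k‖
          ≤ Real.exp ((r' + scale t) * waveNorm L k) * ‖e k‖ := by gcongr
        _ = Real.exp (scale t * waveNorm L k) * (Real.exp (r' * waveNorm L k) * ‖e k‖) := by
            rw [add_mul, Real.exp_add]; ring
        _ ≤ _ := mul_le_mul_of_nonneg_left (he k) (Real.exp_pos _).le
    refine pow_le_pow_left₀ (by positivity) ?_ 2
    calc _ ≤ waveNorm L k * (Real.exp (-t * symbol L k) *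
          (Real.exp (scale t * waveNorm L k) * A)) := by gcongr
      _ = _ := by ring
  calc _ ≤ ∑ k ∈ F, (waveNorm L k * (Real.exp (-t * symbol L k) *
        Real.exp (scale t * waveNorm L k))) ^ 2 * A ^ 2 := Finset.sum_le_sum fun k _ => hpt k
    _ ≤ smoothFactor L t ^ 2 * A ^ 2 := by
        rw [← Finset.sum_mul]
        exact mul_le_mul_of_nonneg_right (sum_sq_kernel_le L ht F) (sq_nonneg _)
    _ = _ := by ring

lemma gevreyBound_gradFlow {t r r' N : ℝ} (ht : 0 < t) (hr' : 0 ≤ r') (hr : r ≤ r' + scale t)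
    {u : L2Field L} (hu : GevreyBound r' N u) :
    GevreyBound r (smoothFactor L t * (N ^ 2 / 2)) (gradFlow t u) := by
  refine gevreyBound_of_gradMode ht hr (fun k i => fieldCoeff_gradFlow ht u k i) ?_
  refine weight_mul_norm_energyCoeff_le (fun k => (Real.exp_pos _).le) (fun j k => ?_) hu
  rw [← Real.exp_add, ← mul_add]
  exact Real.exp_le_exp.mpr (mul_le_mul_of_nonneg_left (waveNorm_le_add L j k) hr')

lemma norm_gradFlow_sub_le {t : ℝ} (ht : 0 < t) (u v : L2Field L) :
    ‖gradFlow t u - gradFlow t v‖ ≤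
      √(area L) * (smoothFactor L t * ((area L)⁻¹ * (‖u - v‖ * (‖u‖ + ‖v‖) / 2))) := by
  have ha := area_pos L
  have hs := smoothFactor_nonneg (L := L) ht.le
  refine GevreyBound.norm_le (r := 0) ?_ le_rfl (by positivity)
  refine gevreyBound_of_gradMode (r' := 0) (e := fun k => energyCoeff u k - energyCoeff v k) ht
    (by linarith [scale_nonneg ht.le]) (fun k i => ?_) fun k => ?_
  · rw [fieldCoeff_sub, fieldCoeff_gradFlow ht, fieldCoeff_gradFlow ht]
    ring
  · rw [zero_mul, Real.exp_zero, one_mul]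
    exact norm_energyCoeff_sub_le u v k

lemma norm_gradFlow_le {t : ℝ} (ht : 0 < t) (u : L2Field L) :
    ‖gradFlow t u‖ ≤ √(area L) * (smoothFactor L t * ((area L)⁻¹ * (‖u‖ ^ 2 / 2))) := by
  have ha := area_pos L
  have hs := smoothFactor_nonneg (L := L) ht.le
  refine GevreyBound.norm_le (r := 0) ?_ le_rfl (by positivity)
  refine gevreyBound_of_gradMode (r' := 0) (e := energyCoeff u) ht
    (by linarith [scale_nonneg ht.le]) (fun k i => fieldCoeff_gradFlow ht u k i) fun k => ?_
  rw [zero_mul, Real.exp_zero, one_mul]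
  exact norm_energyCoeff_le u k

end Gevrey

/-! ### Duhamel's integral -/

section Duhamel

variable {L : Fin 2 → ℝ} [∀ i, Fact (0 < L i)]

lemma smoothFactor_mul_exp {s τ t : ℝ} (hst : s + τ = t) :
    smoothFactor L s * Real.exp (growthRate L * τ) =
      smoothConst L * Real.exp (growthRate L * t) * (1 + s ^ (-(1 / 2) : ℝ)) := by
  rw [smoothFactor, mul_right_comm, mul_assoc (smoothConst L), ← Real.exp_add, ← mul_add, hst]

lemma smoothFactor_le {s t : ℝ} (hs : 0 ≤ s) (hst : s ≤ t) :
    smoothFactor L s ≤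
      smoothConst L * Real.exp (growthRate L * t) * (1 + s ^ (-(1 / 2) : ℝ)) := by
  have h1 := (smoothConst_pos L).le
  have h2 := growthRate_nonneg L
  have h3 := Real.rpow_nonneg hs (-(1 / 2))
  unfold smoothFactor
  gcongr

lemma norm_energyCoeff_le_of_norm_le {f : L2Field L} {M : ℝ} (hM : ‖f‖ ≤ M) (k : Fin 2 → ℤ) :
    ‖energyCoeff f k‖ ≤ (area L)⁻¹ * (M ^ 2 / 2) := by
  have ha := area_pos L
  refine (norm_energyCoeff_le f k).trans ?_
  gcongr

/-- The integrand of Duhamel's formula is continuous away from its singular endpoint. -/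
lemma continuousOn_gradFlow {u : ℝ → L2Field L} (hu : Continuous u) {M : ℝ} (hM : ∀ τ, ‖u τ‖ ≤ M)
    (t : ℝ) : ContinuousOn (fun τ => gradFlow (t - τ) (u τ)) (Set.Ico 0 t) := by
  refine continuousOn_of_locally_continuousOn fun τ₀ hτ₀ => ?_
  obtain ⟨m, hm1, hm2⟩ := exists_between hτ₀.2
  refine ⟨Set.Iio m, isOpen_Iio, hm1, ?_⟩
  set E := (area L)⁻¹ * (M ^ 2 / 2)
  set D := Real.exp 6 * Real.exp (growthRate L * t) * (scale (t - m) ^ 3)⁻¹ with hD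
  have ha := area_pos L
  refine continuousOn_of_fieldCoeff (b := fun k => D * E * ((1 + waveNorm L k) ^ 2)⁻¹) ?_
    (fun k i => ?_) ?_
  · simp only [mul_pow _ _ 2]
    exact (summable_inv_sq_sq L).mul_left _
  · have : Set.EqOn (fun τ => fieldCoeff (gradFlow (t - τ) (u τ)) k i)
        (fun τ => (Real.exp (-(t - τ) * symbol L k) : ℂ) *
          (Complex.I * (wave L k i : ℂ) * energyCoeff (u τ) k)) (Set.Ico 0 t ∩ Set.Iio m) :=
      fun τ hτ => fieldCoeff_gradFlow (sub_pos.mpr hτ.1.2) _ k i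
    have hc := (continuous_energyCoeff (L := L) k).comp hu
    simp only [Function.comp_def] at hc
    exact ContinuousOn.congr (by fun_prop) this
  · rintro τ ⟨⟨h0, h1⟩, h2⟩ k i
    have h2' : τ < m := h2
    rw [fieldCoeff_gradFlow (sub_pos.mpr h1)]
    refine (norm_gradMode_le k i _).trans ?_
    rw [mul_right_comm D E]
    have h3 : waveNorm L k * Real.exp (-(t - τ) * symbol L k)
        ≤ D * ((1 + waveNorm L k) ^ 2)⁻¹ := by
      refine (waveNorm_mul_exp_le L (sub_pos.mpr h1) k).trans ?_
      have h5 : scale (t - m) ≤ scale (t - τ) := scale_mono (by linarith) (by linarith)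
      have h6 : 0 < scale (t - m) := scale_pos (by linarith)
      have h7 := growthRate_nonneg L
      have h8 : 0 ≤ (scale (t - τ) ^ 3)⁻¹ := inv_nonneg.mpr (pow_nonneg (h6.le.trans h5) 3)
      rw [hD]
      gcongr
      linarith
    have h4 : ‖energyCoeff (u τ) k‖ ≤ E := norm_energyCoeff_le_of_norm_le (hM τ) k
    have h5 := mul_nonneg (waveNorm_nonneg L k) (Real.exp_pos (-(t - τ) * symbol L k)).le
    exact mul_le_mul h3 h4 (norm_nonneg _) (h5.trans h3)

lemma intervalIntegrable_gradFlow {u : ℝ → L2Field L} (hu : Continuous u) {M : ℝ}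
    (hM : ∀ τ, ‖u τ‖ ≤ M) {t : ℝ} (ht : 0 ≤ t) :
    IntervalIntegrable (fun τ => gradFlow (t - τ) (u τ)) volume 0 t := by
  have h1 := (integral_one_add_rpow (a := 0) (t := t) (r := -(1 / 2)) (by norm_num)).1
  rw [intervalIntegrable_iff_integrableOn_Ico_of_le ht] at h1 ⊢
  have ha := area_pos L
  refine (h1.const_mul (√(area L) * (smoothConst L * Real.exp (growthRate L * t) *
    ((area L)⁻¹ * (M ^ 2 / 2))))).mono'
    ((continuousOn_gradFlow hu hM t).aestronglyMeasurable measurableSet_Ico) ?_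
  rw [ae_restrict_iff' measurableSet_Ico]
  refine ae_of_all _ fun τ hτ => ?_
  have hs : 0 < t - τ := sub_pos.mpr hτ.2
  refine (norm_gradFlow_le hs (u τ)).trans ?_
  have h2 := smoothFactor_le (L := L) hs.le (by linarith [hτ.1] : t - τ ≤ t)
  have h3 := smoothFactor_nonneg (L := L) hs.le
  have h4 := hM τ
  have h5 := h3.trans h2
  calc _ ≤ √(area L) * (smoothConst L * Real.exp (growthRate L * t) *
        (1 + (t - τ) ^ (-(1 / 2) : ℝ)) * ((area L)⁻¹ * (M ^ 2 / 2))) := by gcongr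
    _ = _ := by ring

/-- Duhamel's integral. -/
def duhamelTerm (u : ℝ → L2Field L) (t : ℝ) : L2Field L :=
  ∫ τ in (0 : ℝ)..t, gradFlow (t - τ) (u τ)

lemma fieldCoeff_duhamelTerm {u : ℝ → L2Field L} (hu : Continuous u) {M : ℝ}
    (hM : ∀ τ, ‖u τ‖ ≤ M) {t : ℝ} (ht : 0 ≤ t) (k : Fin 2 → ℤ) (i : Fin 2) :
    fieldCoeff (duhamelTerm u t) k i = ∫ τ in (0 : ℝ)..t,
      (Real.exp (-(t - τ) * symbol L k) : ℂ) *
        (Complex.I * (wave L k i : ℂ) * energyCoeff (u τ) k) := by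
  rw [← fieldCoeffL_apply, duhamelTerm,
    ← ContinuousLinearMap.intervalIntegral_comp_comm _ (intervalIntegrable_gradFlow hu hM ht)]
  -- At the endpoint `τ = t` there is no smoothing and `gradFlow` may take its default value.
  apply intervalIntegral.integral_congr_ae
  filter_upwards [compl_mem_ae_iff.mpr (measure_singleton t)] with τ hτ hτ'
  rw [Set.uIoc_of_le ht] at hτ'
  exact fieldCoeff_gradFlow (sub_pos.mpr (lt_of_le_of_ne hτ'.2 hτ)) _ k i

/-- Duhamel's integral is continuous in `L²`: its `k`-th coefficient is bounded by a multiple of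
`(1 + |k̃|)⁻²`, because one may trade a time singularity `(t - τ)^{-3/4}` for this decay. -/
lemma continuousOn_duhamelTerm {u : ℝ → L2Field L} (hu : Continuous u) {M : ℝ}
    (hM : ∀ τ, ‖u τ‖ ≤ M) (T : ℝ) : ContinuousOn (duhamelTerm u) (Set.Icc 0 T) := by
  set E := (area L)⁻¹ * (M ^ 2 / 2) with hE
  have ha := area_pos L
  have hE0 : 0 ≤ E := by positivity
  set D := Real.exp 6 * Real.exp (growthRate L * T) * E *
    (T + T ^ (-(3 / 4) + 1 : ℝ) / (-(3 / 4) + 1)) with hD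
  refine continuousOn_of_fieldCoeff (b := fun k => D * ((1 + waveNorm L k) ^ 2)⁻¹) ?_
    (fun k i => ?_) ?_
  · simp only [mul_pow _ _ 2]
    exact (summable_inv_sq_sq L).mul_left _
  · have : Set.EqOn (fun t => fieldCoeff (duhamelTerm u t) k i)
        (fun t => ∫ τ in (0 : ℝ)..t, (Real.exp (-(t - τ) * symbol L k) : ℂ) *
          (Complex.I * (wave L k i : ℂ) * energyCoeff (u τ) k)) (Set.Icc 0 T) :=
      fun t ht => fieldCoeff_duhamelTerm hu hM ht.1 k i
    have hc := (continuous_energyCoeff (L := L) k).comp hu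
    simp only [Function.comp_def] at hc
    refine ContinuousOn.congr (Continuous.continuousOn ?_) this
    refine intervalIntegral.continuous_parametric_intervalIntegral_of_continuous
      (f := fun t τ => (Real.exp (-(t - τ) * symbol L k) : ℂ) *
        (Complex.I * (wave L k i : ℂ) * energyCoeff (u τ) k)) ?_ continuous_id
    have hc2 : Continuous fun p : ℝ × ℝ => energyCoeff (u p.2) k := hc.comp continuous_snd
    simp only [Function.uncurry_def]
    fun_prop
  · rintro t ⟨h0, h1⟩ k i
    rw [fieldCoeff_duhamelTerm hu hM h0]
    have hpos : 0 ≤ ((1 + waveNorm L k) ^ 2)⁻¹ := by positivity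
    refine (norm_integral_singular_le (r := -(3 / 4)) (c := Real.exp 6 *
      Real.exp (growthRate L * T) * E * ((1 + waveNorm L k) ^ 2)⁻¹) h0 (by norm_num)
      fun τ hτ => ?_).trans ?_
    · have hs : 0 < t - τ := sub_pos.mpr hτ.2
      refine (norm_gradMode_le k i _).trans ?_
      have h3 := waveNorm_mul_exp_le L hs k
      have h4 : ‖energyCoeff (u τ) k‖ ≤ E := norm_energyCoeff_le_of_norm_le (hM τ) k
      have h5 := inv_scale_pow_le hs 3
      rw [show (-(((3 : ℕ) : ℝ) / 4) : ℝ) = -(3 / 4) by norm_num] at h5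
      have h6 : Real.exp (growthRate L * (t - τ)) ≤ Real.exp (growthRate L * T) := by
        have := growthRate_nonneg L
        have := hτ.1
        gcongr
        linarith
      have h7 : 0 ≤ (scale (t - τ) ^ 3)⁻¹ :=
        inv_nonneg.mpr (pow_nonneg (scale_nonneg hs.le) 3)
      calc _ ≤ (Real.exp 6 * Real.exp (growthRate L * (t - τ)) * (scale (t - τ) ^ 3)⁻¹ *
            ((1 + waveNorm L k) ^ 2)⁻¹) * E := by
            apply mul_le_mul h3 h4 (norm_nonneg _)
            positivity
        _ ≤ (Real.exp 6 * Real.exp (growthRate L * T) * (1 + (t - τ) ^ (-(3 / 4) : ℝ)) *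
            ((1 + waveNorm L k) ^ 2)⁻¹) * E := by gcongr
        _ = _ := by ring
    · have h2 : t ^ (-(3 / 4) + 1 : ℝ) ≤ T ^ (-(3 / 4) + 1 : ℝ) :=
        Real.rpow_le_rpow h0 h1 (by norm_num)
      calc _ ≤ Real.exp 6 * Real.exp (growthRate L * T) * E * ((1 + waveNorm L k) ^ 2)⁻¹ *
            (T + T ^ (-(3 / 4) + 1 : ℝ) / (-(3 / 4) + 1)) := by
            rw [sub_zero]
            gcongr
        _ = _ := by rw [hD]; ring

lemma singular_time_le {t T : ℝ} (h0 : 0 ≤ t) (h1 : t ≤ T) :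
    t + t ^ (-(1 / 2) + 1 : ℝ) / (-(1 / 2) + 1) ≤ 3 * max T (T ^ (1 / 2 : ℝ)) := by
  have h2 : t ^ (1 / 2 : ℝ) ≤ T ^ (1 / 2 : ℝ) := Real.rpow_le_rpow h0 h1 (by norm_num)
  have h3 := le_max_left T (T ^ (1 / 2 : ℝ))
  have h4 := le_max_right T (T ^ (1 / 2 : ℝ))
  rw [show (-(1 / 2) + 1 : ℝ) = 1 / 2 by norm_num]
  linarith

/-! ### Existence -/

/-- The radius of analyticity `e^{-t} min (1, t^{1/4}) / (2 C)`. -/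
def radius (C t : ℝ) : ℝ := Real.exp (-t) * scale t / (2 * C)

lemma radius_nonneg {C t : ℝ} (hC : 1 / 2 ≤ C) (ht : 0 ≤ t) : 0 ≤ radius C t := by
  have := scale_nonneg ht
  unfold radius
  positivity

lemma radius_le_scale {C t : ℝ} (hC : 1 / 2 ≤ C) (ht : 0 ≤ t) : radius C t ≤ scale t := by
  have h1 := scale_nonneg ht
  have h2 : Real.exp (-t) ≤ 1 := Real.exp_le_one_iff.mpr (by linarith)
  rw [radius, div_le_iff₀ (by linarith)]
  nlinarith

/-- The growth of the radius is absorbed by the smoothing of the linear flow. -/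
lemma radius_le_add {C s t : ℝ} (hC : 1 / 2 ≤ C) (hs : 0 ≤ s) (hst : s ≤ t) :
    radius C t ≤ radius C s + scale (t - s) := by
  have h1 := scale_le_add hs hst
  have h2 := scale_nonneg hs
  have h3 := scale_nonneg (sub_nonneg.mpr hst)
  have h4 : Real.exp (-t) ≤ Real.exp (-s) := Real.exp_le_exp.mpr (by linarith)
  have h5 : Real.exp (-t) ≤ 1 := Real.exp_le_one_iff.mpr (by linarith)
  have h6 := Real.exp_pos (-t)
  rw [radius, radius, div_add' _ _ _ (by linarith : (2 * C) ≠ 0)]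
  refine div_le_div_of_nonneg_right ?_ (by linarith)
  have h7 : Real.exp (-t) * scale t ≤ Real.exp (-t) * (scale s + scale (t - s)) :=
    mul_le_mul_of_nonneg_left h1 h6.le
  have h8 : Real.exp (-t) * scale s ≤ Real.exp (-s) * scale s :=
    mul_le_mul_of_nonneg_right h4 h2
  have h9 : Real.exp (-t) * scale (t - s) ≤ 1 * scale (t - s) :=
    mul_le_mul_of_nonneg_right h5 h3
  nlinarith

lemma gevreyBound_duhamelTerm {C R T : ℝ} (hC : 1 / 2 ≤ C) (hR : 0 ≤ R)
    (hsmall : 6 * smoothConst L * R * (Real.exp T * max T (T ^ (1 / 2 : ℝ))) ≤ 1)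
    {u : ℝ → L2Field L} {t : ℝ} (ht : t ∈ Set.Icc 0 T)
    (hint : IntervalIntegrable (fun τ => gradFlow (t - τ) (u τ)) volume 0 t)
    (hu : ∀ τ ∈ Set.Icc 0 T, GevreyBound (radius C τ) (R * Real.exp (growthRate L * τ)) (u τ)) :
    GevreyBound (radius C t) (R / 2 * Real.exp (growthRate L * t)) (duhamelTerm u t) := by
  obtain ⟨h0, h1⟩ := ht
  have hB := smoothConst_pos L
  have hμ := growthRate_nonneg L
  set c := smoothConst L * R ^ 2 / 2 * Real.exp (growthRate L * t) ^ 2 with hc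
  have hc0 : 0 ≤ c := by positivity
  have h := gevreyBound_integral (r := radius C t) (c := c) (s := -(1 / 2)) h0 (by norm_num) hc0
    hint fun τ hτ => ?_
  · refine h.mono le_rfl ?_ ?_
    · have := Real.rpow_nonneg h0 (-(1 / 2) + 1)
      have : 0 ≤ t ^ (-(1 / 2) + 1 : ℝ) / (-(1 / 2) + 1) := div_nonneg this (by norm_num)
      positivity
    · have h2 := singular_time_le h0 h1
      set m := max T (T ^ (1 / 2 : ℝ)) with hm
      have hm0 : 0 ≤ m := (h0.trans h1).trans (le_max_left _ _)
      have h3 : Real.exp (growthRate L * t) ≤ Real.exp T := by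
        apply Real.exp_le_exp.mpr
        nlinarith [growthRate_le L]
      set X := Real.exp (growthRate L * t) with hX
      have hX0 : 0 < X := Real.exp_pos _
      have h4 : 6 * smoothConst L * R * (X * m) ≤ 1 := le_trans (by gcongr) hsmall
      calc c * _ ≤ c * (3 * m) := mul_le_mul_of_nonneg_left h2 hc0
        _ = R / 4 * X * (6 * smoothConst L * R * (X * m)) := by rw [hc]; ring
        _ ≤ R / 4 * X * 1 := mul_le_mul_of_nonneg_left h4 (by positivity)
        _ ≤ R / 2 * X := by nlinarith [mul_nonneg hR hX0.le]
  · have hs : 0 < t - τ := sub_pos.mpr hτ.2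
    have hτT : τ ∈ Set.Icc 0 T := ⟨hτ.1, hτ.2.le.trans h1⟩
    have h2 := gevreyBound_gradFlow hs (radius_nonneg hC hτ.1)
      (radius_le_add hC hτ.1 hτ.2.le) (hu τ hτT)
    refine h2.mono le_rfl (mul_nonneg (smoothFactor_nonneg hs.le) (by positivity)) ?_
    have h3 : Real.exp (growthRate L * τ) ≤ Real.exp (growthRate L * t) := by
      have := hτ.2.le
      gcongr
    have h4 := smoothFactor_mul_exp (L := L) (sub_add_cancel t τ)
    have h5 := Real.rpow_nonneg hs.le (-(1 / 2))
    calc _ = (smoothFactor L (t - τ) * Real.exp (growthRate L * τ)) * (R ^ 2 / 2) *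
          Real.exp (growthRate L * τ) := by ring
      _ ≤ (smoothFactor L (t - τ) * Real.exp (growthRate L * τ)) * (R ^ 2 / 2) *
          Real.exp (growthRate L * t) := by
          have := smoothFactor_nonneg (L := L) hs.le
          gcongr
      _ = _ := by rw [h4, hc]; ring

lemma norm_duhamelTerm_sub_le {C R T : ℝ} (hC : 1 / 2 ≤ C) (hR : 0 ≤ R)
    (hsmall : 6 * smoothConst L * R * (Real.exp T * max T (T ^ (1 / 2 : ℝ))) ≤ 1)
    {u v : ℝ → L2Field L} {t d : ℝ} (ht : t ∈ Set.Icc 0 T) (hd : 0 ≤ d)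
    (hintu : IntervalIntegrable (fun τ => gradFlow (t - τ) (u τ)) volume 0 t)
    (hintv : IntervalIntegrable (fun τ => gradFlow (t - τ) (v τ)) volume 0 t)
    (hu : ∀ τ ∈ Set.Icc 0 T, GevreyBound (radius C τ) (R * Real.exp (growthRate L * τ)) (u τ))
    (hv : ∀ τ ∈ Set.Icc 0 T, GevreyBound (radius C τ) (R * Real.exp (growthRate L * τ)) (v τ))
    (huv : ∀ τ ∈ Set.Icc 0 T, ‖u τ - v τ‖ ≤ d) :
    ‖duhamelTerm u t - duhamelTerm v t‖ ≤ 1 / 2 * d := by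
  obtain ⟨h0, h1⟩ := ht
  have hB := smoothConst_pos L
  have hμ := growthRate_nonneg L
  have ha := area_pos L
  set X := Real.exp (growthRate L * t) with hX
  have hX0 : 0 < X := Real.exp_pos _
  rw [duhamelTerm, duhamelTerm, ← intervalIntegral.integral_sub hintu hintv]
  refine (norm_integral_singular_le (r := -(1 / 2)) (c := smoothConst L * R * X * d) h0
    (by norm_num) fun τ hτ => ?_).trans ?_
  · have hs : 0 < t - τ := sub_pos.mpr hτ.2
    have hτT : τ ∈ Set.Icc 0 T := ⟨hτ.1, hτ.2.le.trans h1⟩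
    have h2 := norm_gradFlow_sub_le hs (u τ) (v τ)
    have h3 := (hu τ hτT).norm_le (radius_nonneg hC hτ.1) (by positivity)
    have h4 := (hv τ hτT).norm_le (radius_nonneg hC hτ.1) (by positivity)
    have h5 := huv τ hτT
    have h6 := smoothFactor_mul_exp (L := L) (sub_add_cancel t τ)
    have h7 := smoothFactor_nonneg (L := L) hs.le
    refine h2.trans ?_
    calc _ ≤ √(area L) * (smoothFactor L (t - τ) * ((area L)⁻¹ * (d *
          (√(area L) * (R * Real.exp (growthRate L * τ)) +
            √(area L) * (R * Real.exp (growthRate L * τ))) / 2))) := by gcongr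
      _ = (√(area L) * √(area L)) * (area L)⁻¹ *
          (smoothFactor L (t - τ) * Real.exp (growthRate L * τ)) * R * d := by ring
      _ = _ := by
          rw [Real.mul_self_sqrt ha.le, mul_inv_cancel₀ ha.ne', h6]
          ring
  · have h2 := singular_time_le h0 h1
    set m := max T (T ^ (1 / 2 : ℝ)) with hm
    have hm0 : 0 ≤ m := (h0.trans h1).trans (le_max_left _ _)
    have h3 : X ≤ Real.exp T := by
      apply Real.exp_le_exp.mpr
      nlinarith [growthRate_le L]
    have h4 : 6 * smoothConst L * R * (X * m) ≤ 1 := le_trans (by gcongr) hsmall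
    rw [sub_zero]
    calc _ ≤ smoothConst L * R * X * d * (3 * m) :=
          mul_le_mul_of_nonneg_left h2 (by positivity)
      _ = d / 2 * (6 * smoothConst L * R * (X * m)) := by ring
      _ ≤ d / 2 * 1 := mul_le_mul_of_nonneg_left h4 (by positivity)
      _ = _ := by ring

/-- The solution, as the fixed point of Duhamel's formula among the curves that obey the Gevrey
bound; such curves form a closed set in the space of continuous curves in `L²`. -/
theorem exists_solution {C R T : ℝ} (hT : 0 < T) (hC : 1 / 2 ≤ C) (hR : 0 ≤ R) {u₀ : L2Field L}
    (hu₀ : Real.exp 6 * ((√(area L))⁻¹ * ‖u₀‖) ≤ R / 2)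
    (hsmall : 6 * smoothConst L * R * (Real.exp T * max T (T ^ (1 / 2 : ℝ))) ≤ 1) :
    ∃ u : ℝ → L2Field L, IsMildSolution L T u₀ u ∧
      ∀ t ∈ Set.Icc 0 T, GevreyBound (radius C t) (R * Real.exp (growthRate L * t)) (u t) := by
  have ha := area_pos L
  set X := C(Set.Icc 0 T, L2Field L) with hX
  set e : X → ℝ → L2Field L := fun u => Set.IccExtend hT.le u with he
  have hec : ∀ u : X, Continuous (e u) := fun u => u.continuous.Icc_extend'
  have heM : ∀ (u : X) τ, ‖e u τ‖ ≤ ‖u‖ := fun u τ => u.norm_coe_le_norm _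
  have heapp : ∀ (u : X) (t : ℝ) (ht : t ∈ Set.Icc 0 T), e u t = u ⟨t, ht⟩ := fun u t ht =>
    Set.IccExtend_of_mem hT.le u ht
  have hint : ∀ (u : X) {t : ℝ}, 0 ≤ t →
      IntervalIntegrable (fun τ => gradFlow (t - τ) (e u τ)) volume 0 t := fun u t ht =>
    intervalIntegrable_gradFlow (hec u) (heM u) ht
  set Φ : X → X := fun u =>
    { toFun := fun t => semigroup L t u₀ - duhamelTerm (e u) t
      continuous_toFun := continuousOn_iff_continuous_domRestrict.mp
        ((continuousOn_semigroup u₀ T).sub (continuousOn_duhamelTerm (hec u) (heM u) T)) } with hΦ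
  set S : Set X := {u | ∀ t : Set.Icc 0 T,
    GevreyBound (radius C t) (R * Real.exp (growthRate L * t)) (u t)} with hS
  have hSe : ∀ u ∈ S, ∀ τ ∈ Set.Icc 0 T,
      GevreyBound (radius C τ) (R * Real.exp (growthRate L * τ)) (e u τ) := fun u hu τ hτ => by
    rw [heapp u τ hτ]
    exact hu ⟨τ, hτ⟩
  have hSc : IsComplete S := by
    apply IsClosed.isComplete
    rw [hS, Set.ofPred_forall]
    refine isClosed_iInter fun t => ?_
    exact (isClosed_gevreyBound (L := L) (radius C t)
      (R * Real.exp (growthRate L * t))).preimage (by fun_prop)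
  have hmaps : Set.MapsTo Φ S S := by
    intro u hu t
    have h0 := t.2.1
    have h1 := gevreyBound_duhamelTerm hC hR hsmall t.2 (hint u h0) (hSe u hu)
    have h2 : GevreyBound (radius C t) (R / 2 * Real.exp (growthRate L * t))
        (semigroup L t u₀) := by
      refine (gevreyBound_semigroup h0 u₀).mono (radius_le_scale hC h0) (by positivity) ?_
      have := mul_le_mul_of_nonneg_right hu₀ (Real.exp_pos (growthRate L * t)).le
      linarith
    refine (h2.sub h1 (by positivity) (by positivity)).mono le_rfl (by positivity) ?_
    linarith
  have hcontr : ContractingWith (1 / 2) (hmaps.restrict Φ S S) := by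
    refine ⟨by norm_num [← NNReal.coe_lt_coe], LipschitzWith.of_dist_le_mul fun u v => ?_⟩
    rw [Subtype.dist_eq, Subtype.dist_eq]
    refine (ContinuousMap.dist_le (by positivity)).mpr fun t => ?_
    have h : ‖duhamelTerm (e u.1) t - duhamelTerm (e v.1) t‖ ≤ 1 / 2 * dist u.1 v.1 := by
      refine norm_duhamelTerm_sub_le hC hR hsmall t.2 dist_nonneg (hint _ t.2.1) (hint _ t.2.1)
        (hSe _ u.2) (hSe _ v.2) fun τ hτ => ?_
      rw [heapp _ τ hτ, heapp _ τ hτ, ← dist_eq_norm]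
      exact ContinuousMap.dist_apply_le_dist _
    rw [dist_eq_norm, Set.MapsTo.val_restrict_apply, Set.MapsTo.val_restrict_apply]
    have e1 : Φ u.1 t - Φ v.1 t = -(duhamelTerm (e u.1) t - duhamelTerm (e v.1) t) := by
      change (semigroup L t u₀ - duhamelTerm (e u.1) t)
        - (semigroup L t u₀ - duhamelTerm (e v.1) t) = _
      abel
    rw [e1, norm_neg]
    simpa using h
  have h0S : (0 : X) ∈ S := by
    intro t F
    change ∑ k ∈ F, ∑ i, (Real.exp (radius C t * waveNorm L k) *
      ‖fieldCoeff (0 : L2Field L) k i‖) ^ 2 ≤ _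
    have : ∀ k i, fieldCoeff (0 : L2Field L) k i = 0 := fun k i => (fieldCoeffL k i).map_zero
    simp only [this, norm_zero, mul_zero, ne_eq, OfNat.ofNat_ne_zero,
      not_false_eq_true, zero_pow, Finset.sum_const_zero]
    positivity
  obtain ⟨u, huS, hfix, -⟩ := hcontr.exists_fixedPoint' hSc hmaps h0S (edist_ne_top _ _)
  refine ⟨e u, ⟨(hec u).continuousOn, fun t ht => hint u ht.1, fun t ht => ?_⟩, hSe u huS⟩
  have ht' : t ∈ Set.Icc 0 T := ⟨ht.1, ht.2.le⟩
  have h1 : Φ u ⟨t, ht'⟩ = u ⟨t, ht'⟩ := by rw [hfix]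
  rw [heapp u t ht', ← h1]
  rfl

/-! ### Uniqueness -/

/-- Two mild solutions with the same data agree: on a short time interval after a time up to which
they agree, Duhamel's formula bounds the maximum of their distance by half of itself. -/
theorem IsMildSolution.eqOn {T : ℝ} {u₀ : L2Field L} {u v : ℝ → L2Field L}
    (hu : IsMildSolution L T u₀ u) (hv : IsMildSolution L T u₀ v) :
    Set.EqOn v u (Set.Ico 0 T) := by
  intro T' hT'
  have ha := area_pos L
  have hB := smoothConst_pos L
  have hsub : Set.Icc 0 T' ⊆ Set.Ico 0 T := fun t ht => ⟨ht.1, ht.2.trans_lt hT'.2⟩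
  obtain ⟨M₁, hM₁⟩ := isCompact_Icc.exists_bound_of_continuousOn (hu.continuousOn.mono hsub)
  obtain ⟨M₂, hM₂⟩ := isCompact_Icc.exists_bound_of_continuousOn (hv.continuousOn.mono hsub)
  set c := √(area L) * (smoothConst L * Real.exp (growthRate L * T') *
    ((area L)⁻¹ * ((|M₁| + |M₂|) / 2))) with hc
  have hc0 : 0 ≤ c := by positivity
  have hdiff : ∀ t ∈ Set.Icc 0 T', ∀ τ ∈ Set.Ico 0 t,
      ‖gradFlow (t - τ) (u τ) - gradFlow (t - τ) (v τ)‖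
        ≤ c * ‖u τ - v τ‖ * (1 + (t - τ) ^ (-(1 / 2) : ℝ)) := by
    intro t ht τ hτ
    have hs : 0 < t - τ := sub_pos.mpr hτ.2
    have hτ' : τ ∈ Set.Icc 0 T' := ⟨hτ.1, hτ.2.le.trans ht.2⟩
    have h1 := (hM₁ τ hτ').trans (le_abs_self _)
    have h2 := (hM₂ τ hτ').trans (le_abs_self _)
    have h3 := smoothFactor_le (L := L) hs.le (by linarith [hτ.1, ht.2] : t - τ ≤ T')
    have h4 := smoothFactor_nonneg (L := L) hs.le
    refine (norm_gradFlow_sub_le hs (u τ) (v τ)).trans ?_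
    calc _ ≤ √(area L) * (smoothConst L * Real.exp (growthRate L * T') *
          (1 + (t - τ) ^ (-(1 / 2) : ℝ)) *
          ((area L)⁻¹ * (‖u τ - v τ‖ * (|M₁| + |M₂|) / 2))) := by gcongr
      _ = _ := by rw [hc]; ring
  obtain ⟨δ, hδ, hδc⟩ : ∃ δ : ℝ, 0 < δ ∧
      c * (δ + δ ^ (-(1 / 2) + 1 : ℝ) / (-(1 / 2) + 1)) ≤ 1 / 2 := by
    have hcont : ContinuousAt (fun δ : ℝ => c * (δ + δ ^ (-(1 / 2) + 1 : ℝ) / (-(1 / 2) + 1)))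
        0 := by
      have := Real.continuousAt_rpow_const 0 (-(1 / 2) + 1) (Or.inr (by norm_num))
      fun_prop
    have h0 : (fun δ : ℝ => c * (δ + δ ^ (-(1 / 2) + 1 : ℝ) / (-(1 / 2) + 1))) 0 < 1 / 2 := by
      simp only [Real.zero_rpow (by norm_num : (-(1 / 2) + 1 : ℝ) ≠ 0)]
      norm_num
    have h1 := hcont.eventually_lt_const h0
    obtain ⟨δ, h2, h3⟩ := ((h1.filter_mono nhdsWithin_le_nhds).and
      (self_mem_nhdsWithin (s := Set.Ioi (0 : ℝ)))).exists
    exact ⟨δ, h3, h2.le⟩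
  have step : ∀ n : ℕ, ∀ t ∈ Set.Icc 0 T', t ≤ n * δ → u t = v t := by
    intro n
    induction n with
    | zero =>
      intro t ht htn
      have ht0 : t = 0 := le_antisymm (by simpa using htn) ht.1
      rw [hu.duhamel t (hsub ht), hv.duhamel t (hsub ht), ht0]
      simp
    | succ n ih =>
      set b := min T' ((n + 1 : ℕ) * δ) with hb
      have hb0 : 0 ≤ b := le_min hT'.1 (by positivity)
      have hbT : Set.Icc 0 b ⊆ Set.Icc 0 T' := Set.Icc_subset_Icc_right (min_le_left _ _)
      obtain ⟨s, hs, hmax⟩ := isCompact_Icc.exists_isMaxOn (Set.nonempty_Icc.mpr hb0)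
        (((hu.continuousOn.mono (hbT.trans hsub)).sub
          (hv.continuousOn.mono (hbT.trans hsub))).norm)
      have hmax' : ∀ t ∈ Set.Icc 0 b, ‖u t - v t‖ ≤ ‖u s - v s‖ := fun t ht => hmax ht
      have hs0 : ‖u s - v s‖ = 0 := by
        rcases le_total s (n * δ) with hsn | hsn
        · rw [ih s (hbT hs) hsn, sub_self, norm_zero]
        have hn0 : 0 ≤ n * δ := by positivity
        have hsT := hsub (hbT hs)
        have hIu := hu.integrable s hsT
        have hIv := hv.integrable s hsT
        have hI := hIu.sub hIv
        have hmem : n * δ ∈ Set.uIcc 0 s := by rw [Set.uIcc_of_le hs.1]; exact ⟨hn0, hsn⟩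
        have hI1 := hI.mono_set (Set.uIcc_subset_uIcc_left hmem)
        have hI2 := hI.mono_set (Set.uIcc_subset_uIcc_right hmem)
        have e1 : u s - v s = -∫ τ in (0 : ℝ)..s,
            (gradFlow (s - τ) (u τ) - gradFlow (s - τ) (v τ)) := by
          have h2 := intervalIntegral.integral_sub hIu hIv
          rw [hu.duhamel s hsT, hv.duhamel s hsT]
          simp only [gradFlow]
          rw [h2]
          abel
        have e2 : ∫ τ in (0 : ℝ)..(n * δ),
            (gradFlow (s - τ) (u τ) - gradFlow (s - τ) (v τ)) = 0 := by
          rw [← intervalIntegral.integral_zero (E := L2Field L) (μ := volume) (a := (0 : ℝ))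
            (b := n * δ)]
          refine intervalIntegral.integral_congr fun τ hτ => ?_
          rw [Set.uIcc_of_le hn0] at hτ
          rw [ih τ ⟨hτ.1, (hτ.2.trans hsn).trans (hbT hs).2⟩ hτ.2, sub_self]
        have e3 := intervalIntegral.integral_add_adjacent_intervals hI1 hI2
        have e4 : u s - v s = -∫ τ in (n * δ)..s,
            (gradFlow (s - τ) (u τ) - gradFlow (s - τ) (v τ)) := by
          rw [e1, ← sub_eq_zero]
          simp only [gradFlow] at e2 e3 ⊢
          rw [← e3, e2]
          abel
        have h5 := norm_integral_singular_le (r := -(1 / 2)) (c := c * ‖u s - v s‖) hsn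
          (by norm_num) (f := fun τ => gradFlow (s - τ) (u τ) - gradFlow (s - τ) (v τ))
          fun τ hτ => ?_
        · have h6 : s - n * δ ≤ δ := by
            have := hs.2.trans (min_le_right _ _)
            push_cast at this
            linarith
          have h7 : 0 ≤ s - n * δ := by linarith
          have h8 : (s - n * δ) ^ (-(1 / 2) + 1 : ℝ) ≤ δ ^ (-(1 / 2) + 1 : ℝ) :=
            Real.rpow_le_rpow h7 h6 (by norm_num)
          have h9 : ‖u s - v s‖ ≤ ‖u s - v s‖ * (1 / 2) := by
            calc ‖u s - v s‖ = ‖∫ τ in (n * δ)..s,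
                  (gradFlow (s - τ) (u τ) - gradFlow (s - τ) (v τ))‖ := by
                  conv_lhs => rw [e4]
                  rw [norm_neg]
              _ ≤ _ := h5
              _ ≤ c * ‖u s - v s‖ * (δ + δ ^ (-(1 / 2) + 1 : ℝ) / (-(1 / 2) + 1)) := by
                  gcongr
              _ = ‖u s - v s‖ * (c * (δ + δ ^ (-(1 / 2) + 1 : ℝ) / (-(1 / 2) + 1))) := by ring
              _ ≤ ‖u s - v s‖ * (1 / 2) := mul_le_mul_of_nonneg_left hδc (norm_nonneg _)
          linarith [norm_nonneg (u s - v s)]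
        · have hτ0 : 0 ≤ τ := hn0.trans hτ.1
          refine (hdiff s (hbT hs) τ ⟨hτ0, hτ.2⟩).trans ?_
          have h6 := hmax' τ ⟨hτ0, hτ.2.le.trans hs.2⟩
          have h7 : 0 ≤ (s - τ) ^ (-(1 / 2) : ℝ) := Real.rpow_nonneg (by linarith [hτ.2]) _
          gcongr
      intro t ht htn
      have h1 := hmax' t ⟨ht.1, le_min ht.2 htn⟩
      rw [hs0] at h1
      exact sub_eq_zero.mp (norm_le_zero_iff.mp h1)
  obtain ⟨n, hn⟩ := exists_nat_ge (T' / δ)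
  exact (step n T' ⟨hT'.1, le_rfl⟩ ((div_le_iff₀ hδ).mp hn)).symm

end Duhamel

/-! ### Series of exponentials in several complex variables -/

section Exponentials

/-- The `n`-th Taylor coefficient at `0` of `z ↦ c exp (ℓ z)`. -/
def expTaylor {E : Type*} [NormedAddCommGroup E] [NormedSpace ℂ E] (c : ℂ) (l : E →L[ℂ] ℂ) (n : ℕ) :
    ContinuousMultilinearMap ℂ (fun _ : Fin n => E) ℂ :=
  (c / (n.factorial : ℂ)) •
    (ContinuousMultilinearMap.mkPiAlgebra ℂ (Fin n) ℂ).compContinuousLinearMap fun _ => l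

variable {E : Type*} [NormedAddCommGroup E] [NormedSpace ℂ E]

lemma expTaylor_apply (c : ℂ) (l : E →L[ℂ] ℂ) (n : ℕ) (y : E) :
    (expTaylor c l n fun _ => y) = c * (l y ^ n / (n.factorial : ℂ)) := by
  simp [expTaylor]
  ring

lemma norm_expTaylor_le (c : ℂ) (l : E →L[ℂ] ℂ) (n : ℕ) :
    ‖expTaylor c l n‖ ≤ ‖c‖ * (‖l‖ ^ n / n.factorial) := by
  rw [expTaylor, norm_smul, norm_div, Complex.norm_natCast]
  have h := ContinuousMultilinearMap.norm_compContinuousLinearMap_le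
    (ContinuousMultilinearMap.mkPiAlgebra ℂ (Fin n) ℂ) fun _ => l
  rw [ContinuousMultilinearMap.norm_mkPiAlgebra, one_mul, Finset.prod_const, Finset.card_univ,
    Fintype.card_fin] at h
  calc _ ≤ ‖c‖ / n.factorial * ‖l‖ ^ n := by gcongr
    _ = _ := by ring

/-- A series of exponentials of linear functionals is analytic at `0` if it converges absolutely
with some room: its Taylor series can be summed term by term. -/
lemma analyticAt_tsum_exp {ι : Type*} {c : ι → ℂ} {l : ι → E →L[ℂ] ℂ} {r : ℝ} (hr : 0 < r)
    (h : Summable fun k => ‖c k‖ * Real.exp (r * ‖l k‖)) :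
    AnalyticAt ℂ (fun z => ∑' k, c k * Complex.exp (l k z)) 0 := by
  have hterm : ∀ n k, ‖expTaylor (c k) (l k) n‖ * r ^ n ≤ ‖c k‖ * Real.exp (r * ‖l k‖) := by
    intro n k
    calc ‖expTaylor (c k) (l k) n‖ * r ^ n ≤ ‖c k‖ * (‖l k‖ ^ n / n.factorial) * r ^ n := by
          gcongr
          exact norm_expTaylor_le _ _ _
      _ = ‖c k‖ * ((r * ‖l k‖) ^ n / n.factorial) := by ring
      _ ≤ _ := by
          gcongr
          exact Real.pow_div_factorial_le_exp _ (by positivity) n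
  have hsum : ∀ n, Summable fun k => ‖expTaylor (c k) (l k) n‖ := by
    intro n
    refine (h.mul_right ((r ^ n)⁻¹)).of_nonneg_of_le (fun k => norm_nonneg _) fun k => ?_
    rw [← div_eq_mul_inv, le_div_iff₀ (by positivity)]
    exact hterm n k
  set p : FormalMultilinearSeries ℂ E ℂ := fun n => ∑' k, expTaylor (c k) (l k) n with hp
  refine HasFPowerSeriesOnBall.analyticAt (p := p) (r := ENNReal.ofReal r) ⟨?_, ?_, ?_⟩
  · refine p.le_radius_of_bound (r := r.toNNReal) (∑' k, ‖c k‖ * Real.exp (r * ‖l k‖)) fun n => ?_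
    rw [Real.coe_toNNReal _ hr.le]
    calc ‖p n‖ * r ^ n ≤ (∑' k, ‖expTaylor (c k) (l k) n‖) * r ^ n := by
          gcongr
          exact norm_tsum_le_tsum_norm (hsum n)
      _ = ∑' k, ‖expTaylor (c k) (l k) n‖ * r ^ n := tsum_mul_right.symm
      _ ≤ _ := ((hsum n).mul_right _).tsum_le_tsum (hterm n) h
  · exact ENNReal.ofReal_pos.mpr hr
  · intro y hy
    rw [Metric.eball_ofReal, mem_ball_zero_iff] at hy
    rw [zero_add]
    have hpn : ∀ n, HasSum (fun k => c k * (l k y ^ n / (n.factorial : ℂ)))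
        (p n fun _ => y) := by
      intro n
      have h1 := ((hsum n).of_norm.hasSum).mapL
        (ContinuousMultilinearMap.apply ℂ (fun _ : Fin n => E) ℂ fun _ => y)
      simp only [ContinuousMultilinearMap.apply_apply, expTaylor_apply] at h1
      exact h1
    have hexp : ∀ k, HasSum (fun n : ℕ => c k * (l k y ^ n / (n.factorial : ℂ)))
        (c k * Complex.exp (l k y)) := by
      intro k
      have h1 := NormedSpace.expSeries_div_hasSum_exp (l k y)
      rw [← Complex.exp_eq_exp_ℂ] at h1
      exact h1.mul_left _
    have hexpn : ∀ k, HasSum (fun n : ℕ => ‖c k * (l k y ^ n / (n.factorial : ℂ))‖)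
        (‖c k‖ * Real.exp ‖l k y‖) := by
      intro k
      have h1 := NormedSpace.expSeries_div_hasSum_exp ‖l k y‖
      rw [← Real.exp_eq_exp_ℝ] at h1
      refine (h1.mul_left ‖c k‖).congr_fun fun n => ?_
      rw [norm_mul, norm_div, norm_pow, Complex.norm_natCast]
    have hdouble : Summable fun q : ι × ℕ => c q.1 * (l q.1 y ^ q.2 / (q.2.factorial : ℂ)) := by
      apply Summable.of_norm
      refine (summable_prod_of_nonneg fun _ => norm_nonneg _).mpr
        ⟨fun k => (hexpn k).summable, ?_⟩
      simp only [(hexpn _).tsum_eq]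
      refine h.of_nonneg_of_le (fun k => by positivity) fun k => ?_
      gcongr
      calc ‖l k y‖ ≤ ‖l k‖ * ‖y‖ := (l k).le_opNorm y
        _ ≤ ‖l k‖ * r := by gcongr
        _ = _ := mul_comm _ _
    have h1 := hdouble.hasSum.prod_fiberwise hexp
    have h2 := ((Equiv.prodComm ℕ ι).hasSum_iff.mpr hdouble.hasSum).prod_fiberwise hpn
    rw [h1.tsum_eq]
    exact h2

end Exponentials

/-! ### The holomorphic extension -/

section Extension

variable {L : Fin 2 → ℝ}

/-- The linear functional `z ↦ i k̃ · z` on `ℂ²`. -/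
def phaseL (L : Fin 2 → ℝ) (k : Fin 2 → ℤ) : (Fin 2 → ℂ) →L[ℂ] ℂ :=
  ∑ j, (Complex.I * (wave L k j : ℂ)) • ContinuousLinearMap.proj j

lemma phaseL_apply (k : Fin 2 → ℤ) (z : Fin 2 → ℂ) :
    phaseL L k z = ∑ j, Complex.I * (wave L k j : ℂ) * z j := by
  simp [phaseL, Fin.sum_univ_two]

lemma norm_phaseL_le (k : Fin 2 → ℤ) : ‖phaseL L k‖ ≤ 2 * waveNorm L k := by
  refine ContinuousLinearMap.opNorm_le_bound _ (by linarith [waveNorm_nonneg L k]) fun z => ?_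
  rw [phaseL_apply]
  calc _ ≤ ∑ j, ‖Complex.I * (wave L k j : ℂ) * z j‖ := norm_sum_le _ _
    _ ≤ ∑ _j : Fin 2, waveNorm L k * ‖z‖ := by
        refine Finset.sum_le_sum fun j _ => ?_
        rw [norm_mul, norm_mul, Complex.norm_I, one_mul, Complex.norm_real, Real.norm_eq_abs]
        exact mul_le_mul (abs_wave_le L k j) (norm_le_pi_norm z j) (norm_nonneg _)
          (waveNorm_nonneg L k)
    _ = _ := by rw [Fin.sum_univ_two]; ring

lemma norm_exp_phaseL_le (k : Fin 2 → ℤ) (z : Fin 2 → ℂ) :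
    ‖Complex.exp (phaseL L k z)‖ ≤ Real.exp (√(∑ i, (z i).im ^ 2) * waveNorm L k) := by
  rw [Complex.norm_exp]
  apply Real.exp_le_exp.mpr
  have h1 : (phaseL L k z).re = ∑ j, -wave L k j * (z j).im := by
    rw [phaseL_apply, Complex.re_sum]
    refine Finset.sum_congr rfl fun j _ => ?_
    simp [mul_assoc]
  rw [h1]
  refine (Real.sum_mul_le_sqrt_mul_sqrt _ _ _).trans_eq ?_
  simp only [neg_sq]
  rw [mul_comm]
  rfl

lemma exp_phaseL_add_period (k : Fin 2 → ℤ) (z : Fin 2 → ℂ) (j : Fin 2) (hL : L j ≠ 0) :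
    Complex.exp (phaseL L k (z + Pi.single j (L j : ℂ))) = Complex.exp (phaseL L k z) := by
  have h1 : phaseL L k (Pi.single j (L j : ℂ)) = (k j : ℂ) * (2 * Real.pi * Complex.I) := by
    rw [phaseL_apply, Finset.sum_eq_single j]
    · have hL' : (L j : ℂ) ≠ 0 := Complex.ofReal_ne_zero.mpr hL
      rw [Pi.single_eq_same, wave]
      push_cast
      field_simp
    · intro i _ hi
      rw [Pi.single_eq_of_ne hi, mul_zero]
    · simp
  rw [map_add, h1, Complex.exp_add, Complex.exp_int_mul_two_pi_mul_I, mul_one]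

lemma char_coe (k : Fin 2 → ℤ) (x : Fin 2 → ℝ) :
    char L k (fun j => (x j : AddCircle (L j))) = Complex.exp (phaseL L k fun j => (x j : ℂ)) := by
  rw [char_apply, phaseL_apply, Complex.exp_sum]
  refine Finset.prod_congr rfl fun j _ => ?_
  rw [fourier_coe_apply, wave]
  congr 1
  push_cast
  ring

variable [∀ i, Fact (0 < L i)]

lemma summable_exp_neg_waveNorm {δ : ℝ} (hδ : 0 < δ) :
    Summable fun k => Real.exp (-(δ * waveNorm L k)) := by
  set q := min 1 (δ / 4) with hq
  have hq0 : 0 < q := lt_min one_pos (by linarith)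
  refine (summable_inv_pow_four L hq0 (min_le_left _ _)).of_nonneg_of_le
    (fun k => (Real.exp_pos _).le) fun k => ?_
  have hn := waveNorm_nonneg L k
  rw [Real.exp_neg]
  apply inv_anti₀ (by positivity)
  have h1 : 1 + q * waveNorm L k ≤ Real.exp (q * waveNorm L k) := by
    linarith [Real.add_one_le_exp (q * waveNorm L k)]
  calc _ ≤ Real.exp (q * waveNorm L k) ^ 4 := pow_le_pow_left₀ (by positivity) h1 4
    _ = Real.exp (4 * q * waveNorm L k) := by
        rw [← Real.exp_nat_mul]
        congr 1
        push_cast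
        ring
    _ ≤ _ := by
        have : q ≤ δ / 4 := min_le_right _ _
        gcongr
        linarith

lemma GevreyBound.summable {ρ N r : ℝ} {f : L2Field L} (h : GevreyBound ρ N f) (hr : r < ρ)
    (i : Fin 2) : Summable fun k => ‖fieldCoeff f k i‖ * Real.exp (r * waveNorm L k) := by
  have h1 : Summable fun k => ∑ i, (Real.exp (ρ * waveNorm L k) * ‖fieldCoeff f k i‖) ^ 2 :=
    summable_of_sum_le (fun k => Finset.sum_nonneg fun i _ => sq_nonneg _) h
  have h2 := summable_exp_neg_waveNorm (L := L) (δ := 2 * (ρ - r)) (by linarith)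
  refine (h1.add h2).of_nonneg_of_le (fun k => by positivity) fun k => ?_
  have h3 := Finset.single_le_sum
    (f := fun i => (Real.exp (ρ * waveNorm L k) * ‖fieldCoeff f k i‖) ^ 2)
    (fun i _ => sq_nonneg _) (Finset.mem_univ i)
  have h4 : ‖fieldCoeff f k i‖ * Real.exp (r * waveNorm L k)
      = (Real.exp (ρ * waveNorm L k) * ‖fieldCoeff f k i‖) *
        Real.exp (-((ρ - r) * waveNorm L k)) := by
    rw [mul_comm, mul_right_comm, ← Real.exp_add]
    congr 2
    ring
  have h5 : Real.exp (-(2 * (ρ - r) * waveNorm L k))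
      = Real.exp (-((ρ - r) * waveNorm L k)) ^ 2 := by
    rw [← Real.exp_nat_mul]
    congr 1
    push_cast
    ring
  rw [h4, h5]
  nlinarith [sq_nonneg (Real.exp (ρ * waveNorm L k) * ‖fieldCoeff f k i‖ -
    Real.exp (-((ρ - r) * waveNorm L k))),
    sq_nonneg (Real.exp (ρ * waveNorm L k) * ‖fieldCoeff f k i‖),
    sq_nonneg (Real.exp (-((ρ - r) * waveNorm L k)))]

/-- The Fourier series of `f`, evaluated at complex points. -/
def complexExtension (f : L2Field L) (z : Fin 2 → ℂ) : EuclideanSpace ℂ (Fin 2) :=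
  WithLp.toLp 2 fun i => ∑' k, fieldCoeff f k i * Complex.exp (phaseL L k z)

lemma summable_norm_fieldCoeff_mul_exp {ρ N : ℝ} {f : L2Field L} (h : GevreyBound ρ N f)
    {z : Fin 2 → ℂ} (hz : √(∑ i, (z i).im ^ 2) < ρ) (i : Fin 2) :
    Summable fun k => ‖fieldCoeff f k i * Complex.exp (phaseL L k z)‖ := by
  refine (h.summable hz i).of_nonneg_of_le (fun k => norm_nonneg _) fun k => ?_
  rw [norm_mul]
  gcongr
  exact norm_exp_phaseL_le k z

lemma analyticAt_complexExtension {ρ N : ℝ} {f : L2Field L} (h : GevreyBound ρ N f)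
    {z : Fin 2 → ℂ} (hz : √(∑ i, (z i).im ^ 2) < ρ) :
    AnalyticAt ℂ (complexExtension f) z := by
  have hi : ∀ i, AnalyticAt ℂ
      (fun w => ∑' k, fieldCoeff f k i * Complex.exp (phaseL L k w)) z := by
    intro i
    obtain ⟨ρ', h1, h2⟩ := exists_between hz
    set r := (ρ' - √(∑ i, (z i).im ^ 2)) / 2 with hr
    have hr0 : 0 < r := by rw [hr]; linarith
    have h3 : AnalyticAt ℂ (fun w => ∑' k, fieldCoeff f k i * Complex.exp (phaseL L k z) *
        Complex.exp (phaseL L k w)) 0 := by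
      refine analyticAt_tsum_exp hr0 ?_
      refine (h.summable h2 i).of_nonneg_of_le (fun k => by positivity) fun k => ?_
      rw [norm_mul, mul_assoc]
      gcongr
      calc _ ≤ Real.exp (√(∑ i, (z i).im ^ 2) * waveNorm L k) *
            Real.exp (r * (2 * waveNorm L k)) := by
            gcongr
            · exact norm_exp_phaseL_le k z
            · exact norm_phaseL_le k
        _ = Real.exp (ρ' * waveNorm L k) := by
            rw [← Real.exp_add, hr]
            congr 1
            ring
    have h4 : AnalyticAt ℂ (fun w : Fin 2 → ℂ => w - z) z := by fun_prop
    have h5 : AnalyticAt ℂ (fun w => ∑' k, fieldCoeff f k i * Complex.exp (phaseL L k z) *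
        Complex.exp (phaseL L k w)) (z - z) := by rwa [sub_self]
    refine (h5.comp_of_eq h4 rfl).congr (Filter.Eventually.of_forall fun w => ?_)
    simp only [Function.comp]
    refine tsum_congr fun k => ?_
    rw [mul_assoc, ← Complex.exp_add, ← map_add, add_sub_cancel]
  have h6 := AnalyticAt.pi hi
  exact ((PiLp.continuousLinearEquiv 2 ℂ (fun _ : Fin 2 => ℂ)).symm.toContinuousLinearMap.analyticAt
    _).comp h6

lemma complexExtension_add_period (f : L2Field L) (z : Fin 2 → ℂ) (j : Fin 2) :
    complexExtension f (z + Pi.single j (L j : ℂ)) = complexExtension f z := by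
  simp only [complexExtension, exp_phaseL_add_period _ _ _ (period_pos L j).ne']

/-- The covering map of the torus is measure-preserving on each period cell. -/
lemma measurePreserving_covering (L : Fin 2 → ℝ) [∀ i, Fact (0 < L i)] (a : Fin 2 → ℝ) :
    MeasurePreserving (fun (x : Fin 2 → ℝ) (j : Fin 2) => (x j : AddCircle (L j)))
      (volume.restrict (Set.univ.pi fun j => Set.Ioc (a j) (a j + L j)))
      (volume : Measure (Torus L)) := by
  have h := measurePreserving_pi (fun j => volume.restrict (Set.Ioc (a j) (a j + L j)))
    (fun j => (volume : Measure (AddCircle (L j))))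
    fun j => AddCircle.measurePreserving_mk (L j) (a j)
  rwa [← Measure.restrict_pi_pi, ← volume_pi, ← volume_pi] at h

lemma ae_comp_covering {p : Torus L → Prop} (h : ∀ᵐ x, p x) :
    ∀ᵐ x : Fin 2 → ℝ, p fun j => (x j : AddCircle (L j)) := by
  have hcover : ⋃ n : Fin 2 → ℤ, (Set.univ.pi fun j =>
      Set.Ioc ((n j : ℝ) * L j) ((n j : ℝ) * L j + L j)) = (Set.univ : Set (Fin 2 → ℝ)) := by
    refine Set.eq_univ_of_forall fun x => Set.mem_iUnion.mpr ⟨fun j => ⌈x j / L j⌉ - 1, ?_⟩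
    intro j _
    have hL := period_pos L j
    have h1 := Int.le_ceil (x j / L j)
    have h2 := Int.ceil_lt_add_one (x j / L j)
    rw [div_le_iff₀ hL] at h1
    have h3 : (⌈x j / L j⌉ - 1 : ℝ) * L j < x j := by
      rw [← lt_div_iff₀ hL]
      linarith
    constructor
    · push_cast
      exact h3
    · push_cast
      linarith
  rw [← Measure.restrict_univ (μ := (volume : Measure (Fin 2 → ℝ))), ← hcover,
    ae_restrict_iUnion_iff]
  intro n
  exact (measurePreserving_covering L fun j => (n j : ℝ) * L j).quasiMeasurePreserving.ae h

lemma complexExtension_ae_eq {ρ N : ℝ} {f : L2Field L} (h : GevreyBound ρ N f) (hρ : 0 < ρ) :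
    ∀ᵐ x : Fin 2 → ℝ, ∀ i, complexExtension f (fun j => (x j : ℂ)) i
      = ((f (fun j => (x j : AddCircle (L j))) i : ℝ) : ℂ) := by
  rw [ae_all_iff]
  intro i
  have hs : Summable fun k => ‖fieldCoeff f k i‖ := by
    simpa using h.summable hρ i
  obtain ⟨φ, hφ, hφc⟩ := exists_continuous_coeff_eq (L := L) hs
  have h1 : φ =ᵐ[volume] fun x => ((f x i : ℝ) : ℂ) := by
    refine ae_eq_of_coeff_eq ?_ (memLp_component f i) hφc
    exact φ.continuous.memLp_of_hasCompactSupport (HasCompactSupport.of_compactSpace _)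
  filter_upwards [ae_comp_covering h1] with x hx
  rw [← hx, ← (hφ _).tsum_eq]
  simp only [char_coe]
  rfl

/-- The norm of a horizontal slice of the extension, by Parseval's identity. -/
lemma sliceNorm_complexExtension_le {ρ N : ℝ} {f : L2Field L} (h : GevreyBound ρ N f)
    (hN : 0 ≤ N) {y : Fin 2 → ℝ} (hy : √(∑ i, y i ^ 2) < ρ) :
    sliceNorm L (complexExtension f) y ≤ ENNReal.ofReal (√(area L) * N) := by
  set w : Fin 2 → ℂ := fun j => (y j : ℂ) * Complex.I with hw
  have him : ∀ i, (w i).im = y i := fun i => by simp [hw]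
  have hwρ : √(∑ i, (w i).im ^ 2) < ρ := by simpa only [him] using hy
  have hs := summable_norm_fieldCoeff_mul_exp h hwρ
  choose φ hφ hφc using fun i => exists_continuous_coeff_eq (L := L) (hs i)
  set Φ : Torus L → EuclideanSpace ℂ (Fin 2) := fun x => WithLp.toLp 2 fun i => φ i x with hΦ
  have hΦc : Continuous Φ := by fun_prop
  have hcomp : (fun x : Fin 2 → ℝ => complexExtension f
      (fun j => (x j : ℂ) + (y j : ℂ) * Complex.I))
      = Φ ∘ fun (x : Fin 2 → ℝ) (j : Fin 2) => (x j : AddCircle (L j)) := by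
    ext x i
    simp only [complexExtension, hΦ, Function.comp]
    rw [← (hφ i _).tsum_eq]
    refine tsum_congr fun k => ?_
    rw [char_coe, mul_assoc, ← Complex.exp_add, ← map_add, add_comm w]
    rfl
  have hmp := measurePreserving_covering L 0
  simp only [Pi.zero_apply, zero_add] at hmp
  have hmem : ∀ i, MemLp (φ i) 2 (volume : Measure (Torus L)) := fun i =>
    (φ i).continuous.memLp_of_hasCompactSupport (HasCompactSupport.of_compactSpace _)
  have hΦm : MemLp Φ 2 (volume : Measure (Torus L)) :=
    hΦc.memLp_of_hasCompactSupport (HasCompactSupport.of_compactSpace _)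
  rw [sliceNorm, hcomp, eLpNorm_comp_measurePreserving hΦc.aestronglyMeasurable hmp,
    hΦm.eLpNorm_eq_integral_rpow_norm two_ne_zero ENNReal.ofNat_ne_top]
  apply ENNReal.ofReal_le_ofReal
  simp only [ENNReal.toReal_ofNat, Real.rpow_ofNat]
  rw [← one_div, ← Real.sqrt_eq_rpow]
  apply Real.sqrt_le_iff.mpr
  refine ⟨by positivity, ?_⟩
  rw [mul_pow, Real.sq_sqrt (area_pos L).le]
  have h1 : ∫ x, ‖Φ x‖ ^ 2 = ∑ i, ∫ x, ‖φ i x‖ ^ 2 := by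
    rw [← integral_finsetSum]
    · simp only [EuclideanSpace.norm_sq_eq, hΦ]
    · intro i _
      exact (hmem i).integrable_norm_pow (by norm_num)
  have h2 := hasSum_sum (s := Finset.univ) fun i _ => hasSum_norm_coeff_sq (hmem i)
  simp only [hφc] at h2
  rw [← Finset.mul_sum, ← h1] at h2
  have h3 : (area L)⁻¹ * ∫ x, ‖Φ x‖ ^ 2 ≤ N ^ 2 := by
    rw [← h2.tsum_eq]
    refine h2.summable.tsum_le_of_sum_le fun F => le_trans ?_ (h F)
    refine Finset.sum_le_sum fun k _ => Finset.sum_le_sum fun i _ => ?_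
    refine pow_le_pow_left₀ (norm_nonneg _) ?_ 2
    rw [norm_mul, mul_comm]
    have h4 := norm_exp_phaseL_le (L := L) k w
    have h5 := waveNorm_nonneg L k
    refine mul_le_mul_of_nonneg_right (h4.trans ?_) (norm_nonneg _)
    gcongr
  rwa [inv_mul_le_iff₀ (area_pos L)] at h3

end Extension

end KS

end

theorem theorem6p1 (L : Fin 2 → ℝ) [∀ i, Fact (0 < L i)] :
    ∃ C : ℝ, 0 < C ∧
      ∀ u₀ : KS.L2Field L, (∫ x, u₀ x) = 0 →
      ∀ T : ℝ, 0 < T →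
        Real.exp T * max T (T ^ (1 / 2 : ℝ)) * (2 * C * ‖u₀‖) < 1 →
        ∃ u : ℝ → KS.L2Field L,
          KS.IsMildSolution L T u₀ u ∧
          (∀ v : ℝ → KS.L2Field L, KS.IsMildSolution L T u₀ v → Set.EqOn v u (Set.Ico 0 T)) ∧
          ∀ t ∈ Set.Ioo 0 T, ∃ F : (Fin 2 → ℂ) → EuclideanSpace ℂ (Fin 2),
            KS.IsAnalyticExtension L (u t) (KS.strip C t) F ∧
            ∀ y : Fin 2 → ℝ,
              (fun j => (y j : ℂ) * Complex.I) ∈ KS.strip C t →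
              KS.sliceNorm L F y ≤
                ENNReal.ofReal (C * Real.exp (KS.growthRate L * t) * ‖u₀‖) := by
  have ha := KS.area_pos L
  have hsa : 0 < √(KS.area L) := Real.sqrt_pos.mpr ha
  have hB := KS.smoothConst_pos L
  -- The summands serve, in turn, the bound `1 / 2 ≤ C` needed for the radius, the final estimate
  -- on the slices, and the smallness of the nonlinear term.
  set C := 1 + 2 * Real.exp 6 + 6 * Real.exp 6 * KS.smoothConst L / √(KS.area L) with hC
  have hlast : 0 < 6 * Real.exp 6 * KS.smoothConst L / √(KS.area L) := by positivity
  have hexp := Real.exp_pos 6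
  have hC1 : 1 / 2 ≤ C := by linarith
  refine ⟨C, by linarith, fun u₀ _ T hT hsmall => ?_⟩
  set R := 2 * (Real.exp 6 * ((√(KS.area L))⁻¹ * ‖u₀‖)) with hR
  have hR0 : 0 ≤ R := by positivity
  obtain ⟨u, hu, hgev⟩ := KS.exists_solution hT hC1 hR0 (u₀ := u₀) (by rw [hR]; linarith) (by
    have hm : 0 ≤ Real.exp T * max T (T ^ (1 / 2 : ℝ)) :=
      mul_nonneg (Real.exp_pos T).le (hT.le.trans (le_max_left _ _))
    calc _ = Real.exp T * max T (T ^ (1 / 2 : ℝ)) *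
          (2 * (6 * Real.exp 6 * KS.smoothConst L / √(KS.area L)) * ‖u₀‖) := by
          rw [hR]; ring
      _ ≤ Real.exp T * max T (T ^ (1 / 2 : ℝ)) * (2 * C * ‖u₀‖) := by
          gcongr
          linarith
      _ ≤ 1 := hsmall.le)
  have hstrip : ∀ (t : ℝ) (z : Fin 2 → ℂ),
      z ∈ KS.strip C t ↔ √(∑ i, (z i).im ^ 2) < KS.radius C t := by
    intro t z
    rw [KS.radius, lt_div_iff₀ (by linarith), mul_comm]
    rfl
  refine ⟨u, hu, fun v hv => hu.eqOn hv, fun t ht => ⟨KS.complexExtension (u t), ?_, ?_⟩⟩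
  · have hg := hgev t ⟨ht.1.le, ht.2.le⟩
    have hρ : 0 < KS.radius C t :=
      div_pos (mul_pos (Real.exp_pos _) (KS.scale_pos ht.1)) (by linarith)
    exact ⟨fun z hz => KS.analyticAt_complexExtension hg ((hstrip t z).mp hz),
      fun z _ j => KS.complexExtension_add_period (u t) z j, KS.complexExtension_ae_eq hg hρ⟩
  · intro y hy
    have hy' := (hstrip t _).mp hy
    simp only [Complex.mul_im, Complex.ofReal_re, Complex.I_im, mul_one, Complex.ofReal_im,
      Complex.I_re, mul_zero, add_zero] at hy'
    refine (KS.sliceNorm_complexExtension_le (hgev t ⟨ht.1.le, ht.2.le⟩) (by positivity)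
      hy').trans (ENNReal.ofReal_le_ofReal ?_)
    calc _ = √(KS.area L) * (√(KS.area L))⁻¹ * (2 * Real.exp 6) *
          Real.exp (KS.growthRate L * t) * ‖u₀‖ := by rw [hR]; ring
      _ = 2 * Real.exp 6 * Real.exp (KS.growthRate L * t) * ‖u₀‖ := by
          rw [mul_inv_cancel₀ hsa.ne', one_mul]
      _ ≤ _ := by
          gcongr
          linarith
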